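/- Let $(M,J)$ be a compact connected complex manifold of real dimension $2m$, let $g$ be a smooth Hermitian metric on $M$ (a smooth Riemannian metric with $g(J\cdot,J\cdot)=g$), and let $h$ be a smooth section of $\mathrm{Sym}^{1,1}(TM)$, i.e. a smooth section of $\mathrm{End}(TM)$ that is $g$-symmetric and commutes with $J$. Conventions. For an endomorphism $A$ of $T_xM$ commuting with $J$, $\mathrm{tr}^{\mathbb R}A$ and $\mathrm{tr}^{\mathbb C}A$ are its traces as a real endomorphism and as a complex endomorphism of $(T_xM,J)\cong T^{1,0}_xM$. Put $\rho_g(A)=g(JA\,\cdot,\cdot)$ and $\mathrm{Tr}^{\mathbb C}_g(\alpha)=\mathrm{tr}^{\mathbb C}(\rho_g^{-1}(\alpha))$. Let $\omega=g(J\cdot,\cdot)$, let $D^g$ be the Levi-Civita connection and let $\nabla$ be the Chern connection, $g(\nabla_XY,Z)=g(D^g_XY,Z)-\tfrac12 d\omega(JX,Y,Z)$, with torsion $T(X,Y)=\nabla_XY-\nabla_YX-[X,Y]$ and curvature $\Omega(g)(X,Y)=\nabla_{[X,Y]}-[\nabla_X,\nabla_Y]$. The Lee form is $\vartheta(X)=\mathrm{tr}^{\mathbb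 R}(T(X,\cdot))$; the first Chern-Ricci form is $\tilde S(g)(X,Y)=-\mathrm{tr}^{\mathbb C}(J\circ\Omega(g)(X,Y))$; the first Chern-Ricci endomorphism is $S(g)=\rho_g^{-1}(\tilde S(g))$; and the Chern-scalar curvature is $\mathrm{scal}^{\rm Ch}(g)=2\,\mathrm{Tr}^{\mathbb C}_g(\tilde S(g))$. Let $\Delta_g=(D^g)^*D^g=-\mathrm{tr}_g(D^g d\,\cdot)$ be the (nonnegative) Laplace-Beltrami operator. We also write $g$ for the induced scalar products on covectors and on endomorphisms of $T_xM$; the latter is $g(A,B)=\sum_\alpha g(A\tilde e_\alpha,B\tilde e_\alpha)$ for an orthonormal basis $(\tilde e_\alpha)$. Statement. There is $\varepsilon>0$ such that $g_t=g((\mathrm{Id}+th)\,\cdot,\cdot)$ is a smooth Hermitian metric for every $t\in(-\varepsilon,\varepsilon)$, the function $(t,x)\mapsto \mathrm{scal}^{\rm Ch}(g_t)(x)$ is smooth on $(-\varepsilon,\varepsilon)\times M$, and the differential of $\mathrm{scal}^{\rm Ch}$ at $g$ in the direction of $h$ is $$\frac{d}{dt}\Big|_{t=0}\mathrm{scal}^{\rm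 Ch}(g_t)=\Delta_g(\mathrm{tr}^{\mathbb C}h)+g\big(d(\mathrm{tr}^{\mathbb C}h),\vartheta\big)-g\big(h,S(g)\big)$$ at every point of $M$. -/

import Mathlib

set_option maxSynthPendingDepth 3

open scoped Manifold ContDiff
open Bundle

noncomputable section

namespace ChernScal

/-! ### Linear algebra on a complex vector space `E`, with `J` the multiplication by `i` -/

section LinearAlgebra

variable {E : Type*} [NormedAddCommGroup E] [NormedSpace ℂ E]

/-- The complex structure `J` of `E`, as a real endomorphism. -/
def cJ (E : Type*) [NormedAddCommGroup E] [NormedSpace ℂ E] : E →L[ℝ] E :=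
  (Complex.I • ContinuousLinearMap.id ℂ E).restrictScalars ℝ

@[simp] lemma cJ_apply (v : E) : cJ E v = Complex.I • v := rfl

/-- The `ℂ`-linear part `(A - J A J) / 2` of a real endomorphism `A`. It is `A` itself when `A`
commutes with `J`. -/
def complexPart (A : E →L[ℝ] E) : E →ₗ[ℂ] E where
  toFun v := (2⁻¹ : ℝ) • (A v - cJ E (A (cJ E v)))
  map_add' v w := by
    simp only [map_add, smul_add, smul_sub]; abel
  map_smul' c v := by
    have hc : ∀ w : E, c • w = c.re • w + c.im • cJ E w := fun w => by
      conv_lhs => rw [← Complex.re_add_im c]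
      rw [add_smul, mul_smul, cJ_apply, Complex.coe_smul, Complex.coe_smul]
    have hJ : ∀ w : E, cJ E (cJ E w) = -w := fun w => by
      simp [smul_smul]
    rw [RingHom.id_apply, hc v, hc ((2⁻¹ : ℝ) • (A v - cJ E (A (cJ E v))))]
    simp only [map_add, map_smul, map_sub, map_neg, hJ]
    module

lemma complexPart_apply_of_commute (A : E →L[ℝ] E) (hA : ∀ v, A (cJ E v) = cJ E (A v)) (v : E) :
    complexPart A v = A v := by
  change (2⁻¹ : ℝ) • (A v - cJ E (A (cJ E v))) = A v
  have hJ : cJ E (cJ E (A v)) = -(A v) := by simp [smul_smul]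
  rw [hA, hJ]; module

/-- The complex trace `tr^ℂ` of an endomorphism of `(E, J)` commuting with `J`. (It is real on
endomorphisms that are moreover symmetric for a Hermitian scalar product.) -/
def trC (A : E →L[ℝ] E) : ℝ := (LinearMap.trace ℂ E (complexPart A)).re

/-- The musical isomorphism `♯` of a scalar product `B`: `sharp B α` is the vector `v` with
`B v = α`. -/
def sharp (B : E →L[ℝ] E →L[ℝ] ℝ) : (E →L[ℝ] ℝ) →L[ℝ] E := ContinuousLinearMap.inverse B

/-- `ρ_B(A) = B(J A ·, ·)`. -/
def rho (B : E →L[ℝ] E →L[ℝ] ℝ) (A : E →L[ℝ] E) : E →L[ℝ] E →L[ℝ] ℝ := B ∘L (cJ E ∘L A)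

/-- The inverse of `ρ_B`. -/
def rhoInv (B α : E →L[ℝ] E →L[ℝ] ℝ) : E →L[ℝ] E := -(cJ E ∘L (sharp B ∘L α))

lemma rhoInv_rho (B : E ≃L[ℝ] (E →L[ℝ] ℝ)) (A : E →L[ℝ] E) :
    rhoInv (B : E →L[ℝ] E →L[ℝ] ℝ) (rho B A) = A := by
  ext v
  simp [rhoInv, rho, sharp, smul_smul]

variable [FiniteDimensional ℂ E]

/-- The complex trace as a linear functional. -/
def trCL (E : Type*) [NormedAddCommGroup E] [NormedSpace ℂ E] [FiniteDimensional ℂ E] :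
    (E →L[ℝ] E) →L[ℝ] ℝ :=
  haveI : FiniteDimensional ℝ E := FiniteDimensional.complexToReal E
  LinearMap.toContinuousLinearMap
    { toFun := trC
      map_add' := fun A B => by
        have h : complexPart (A + B) = complexPart A + complexPart B := by
          ext v
          change (2⁻¹ : ℝ) • ((A + B) v - cJ E ((A + B) (cJ E v))) =
            (2⁻¹ : ℝ) • (A v - cJ E (A (cJ E v))) + (2⁻¹ : ℝ) • (B v - cJ E (B (cJ E v)))
          simp only [add_apply, map_add]
          module
        simp [trC, h]
      map_smul' := fun r A => by
        have h : complexPart (r • A) = (r : ℂ) • complexPart A := by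
          ext v
          change (2⁻¹ : ℝ) • ((r • A) v - cJ E ((r • A) (cJ E v))) =
            (r : ℂ) • ((2⁻¹ : ℝ) • (A v - cJ E (A (cJ E v))))
          rw [Complex.coe_smul]
          simp only [smul_apply, map_smul]
          module
        simp [trC, h] }

@[simp] lemma trCL_apply (A : E →L[ℝ] E) : trCL E A = trC A := rfl

/-- The real trace `tr^ℝ` as a linear functional. -/
def trRL (E : Type*) [NormedAddCommGroup E] [NormedSpace ℂ E] [FiniteDimensional ℂ E] :
    (E →L[ℝ] E) →L[ℝ] ℝ :=
  haveI : FiniteDimensional ℝ E := FiniteDimensional.complexToReal E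
  LinearMap.toContinuousLinearMap (LinearMap.trace ℝ E ∘ₗ ContinuousLinearMap.coeLM ℝ)

lemma trRL_apply (A : E →L[ℝ] E) : trRL E A = LinearMap.trace ℝ E (A : E →ₗ[ℝ] E) := rfl

/-- The trace of a bilinear form `b` with respect to the scalar product `B`:
`∑ b(eₐ, eₐ)` over a `B`-orthonormal basis `(eₐ)`. -/
def traceForm (B b : E →L[ℝ] E →L[ℝ] ℝ) : ℝ := trRL E (sharp B ∘L b)

/-- The scalar product `B(α, β)` of two covectors. -/
def coInner (B : E →L[ℝ] E →L[ℝ] ℝ) (α β : E →L[ℝ] ℝ) : ℝ := B (sharp B α) (sharp B β)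

/-- The scalar product `B(A, C) = ∑ B(A eₐ, C eₐ)` of two endomorphisms. -/
def endInner (B : E →L[ℝ] E →L[ℝ] ℝ) (A C : E →L[ℝ] E) : ℝ := traceForm B (B.bilinearComp A C)

/-- `Tr^ℂ_B(α) = tr^ℂ(ρ_B⁻¹(α))`. -/
def TrC (B α : E →L[ℝ] E →L[ℝ] ℝ) : ℝ := trC (rhoInv B α)

end LinearAlgebra

/-! ### Hermitian geometry in a holomorphic chart

`G : E → E →L[ℝ] E →L[ℝ] ℝ` gives the components of a metric in a holomorphic chart with values
in `E`, so that the complex structure is the constant `J`. Tensors are evaluated on constant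
(coordinate) vector fields. -/

section Chart

variable {E : Type*} [NormedAddCommGroup E] [NormedSpace ℂ E]

/-- Cyclic rotation of the arguments of a trilinear form. -/
def rot (B : E →L[ℝ] E →L[ℝ] E →L[ℝ] ℝ) : E →L[ℝ] E →L[ℝ] E →L[ℝ] ℝ :=
  (ContinuousLinearMap.flipₗᵢ ℝ E E ℝ).toContinuousLinearEquiv.toContinuousLinearMap ∘L B.flip

@[simp] lemma rot_apply (B : E →L[ℝ] E →L[ℝ] E →L[ℝ] ℝ) (v w u : E) : rot B v w u = B u v w := rfl

/-- The fundamental form `ω = G(J·, ·)`. -/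
def fundForm (G : E → E →L[ℝ] E →L[ℝ] ℝ) (y : E) : E →L[ℝ] E →L[ℝ] ℝ := G y ∘L cJ E

/-- The exterior derivative `dω`. -/
def dFundForm (G : E → E →L[ℝ] E →L[ℝ] ℝ) (y : E) : E →L[ℝ] E →L[ℝ] E →L[ℝ] ℝ :=
  fderiv ℝ (fundForm G) y + rot (rot (fderiv ℝ (fundForm G) y)) + rot (fderiv ℝ (fundForm G) y)

lemma dFundForm_apply (G : E → E →L[ℝ] E →L[ℝ] ℝ) (y v w u : E) :
    dFundForm G y v w u = fderiv ℝ (fundForm G) y v w u + fderiv ℝ (fundForm G) y w u v +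
      fderiv ℝ (fundForm G) y u v w := rfl

/-- Christoffel symbols of the first kind of the Levi-Civita connection, `G(D_v w, u)`. -/
def leviCivitaLow (G : E → E →L[ℝ] E →L[ℝ] ℝ) (y : E) : E →L[ℝ] E →L[ℝ] E →L[ℝ] ℝ :=
  (2⁻¹ : ℝ) • (fderiv ℝ G y + (fderiv ℝ G y).flip - rot (fderiv ℝ G y))

lemma leviCivitaLow_apply (G : E → E →L[ℝ] E →L[ℝ] ℝ) (y v w u : E) :
    leviCivitaLow G y v w u =
      2⁻¹ * (fderiv ℝ G y v w u + fderiv ℝ G y w v u - fderiv ℝ G y u v w) := rfl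

/-- `G(∇_v w, u) = G(D_v w, u) - ½ dω(Jv, w, u)`, with `∇` the Chern connection. -/
def chernLow (G : E → E →L[ℝ] E →L[ℝ] ℝ) (y : E) : E →L[ℝ] E →L[ℝ] E →L[ℝ] ℝ :=
  leviCivitaLow G y - (2⁻¹ : ℝ) • (dFundForm G y ∘L cJ E)

lemma chernLow_apply (G : E → E →L[ℝ] E →L[ℝ] ℝ) (y v w u : E) :
    chernLow G y v w u = leviCivitaLow G y v w u - 2⁻¹ * dFundForm G y (cJ E v) w u := rfl

/-- Raising the last index. -/
def raise (B : E →L[ℝ] E →L[ℝ] ℝ) (K : E →L[ℝ] E →L[ℝ] E →L[ℝ] ℝ) : E →L[ℝ] E →L[ℝ] E :=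
  (ContinuousLinearMap.compL ℝ E (E →L[ℝ] ℝ) E (sharp B)) ∘L K

lemma raise_apply (B : E →L[ℝ] E →L[ℝ] ℝ) (K : E →L[ℝ] E →L[ℝ] E →L[ℝ] ℝ) (v w : E) :
    raise B K v w = sharp B (K v w) := rfl

/-- The Levi-Civita connection: `leviCivita G y v w` is `D_v w` for constant fields `v`, `w`. -/
def leviCivita (G : E → E →L[ℝ] E →L[ℝ] ℝ) (y : E) : E →L[ℝ] E →L[ℝ] E :=
  raise (G y) (leviCivitaLow G y)

/-- The Chern connection: `chern G y v w` is `∇_v w` for constant fields `v`, `w`. So `∇ = d + θ`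
with the `End E`-valued connection form `θ = chern G`. -/
def chern (G : E → E →L[ℝ] E →L[ℝ] ℝ) (y : E) : E →L[ℝ] E →L[ℝ] E := raise (G y) (chernLow G y)

/-- The torsion `T(v, w) = ∇_v w - ∇_w v - [v, w]` of the Chern connection. -/
def chernTorsion (G : E → E →L[ℝ] E →L[ℝ] ℝ) (y : E) : E →L[ℝ] E →L[ℝ] E :=
  chern G y - (chern G y).flip

lemma chernTorsion_apply (G : E → E →L[ℝ] E →L[ℝ] ℝ) (y v w : E) :
    chernTorsion G y v w = chern G y v w - chern G y w v := rfl

/-- The Chern curvature `Ω(v, w) = ∇_{[v, w]} - [∇_v, ∇_w] = -(dθ + θ ∧ θ)(v, w)`. -/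
def chernCurv (G : E → E →L[ℝ] E →L[ℝ] ℝ) (y : E) : E →L[ℝ] E →L[ℝ] E →L[ℝ] E :=
  -((fderiv ℝ (chern G) y - (fderiv ℝ (chern G) y).flip) +
    ((ContinuousLinearMap.compL ℝ E E E).bilinearComp (chern G y) (chern G y) -
      ((ContinuousLinearMap.compL ℝ E E E).bilinearComp (chern G y) (chern G y)).flip))

lemma chernCurv_apply (G : E → E →L[ℝ] E →L[ℝ] ℝ) (y v w u : E) :
    chernCurv G y v w u =
      -((fderiv ℝ (chern G) y v w u - fderiv ℝ (chern G) y w v u) +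
        (chern G y v (chern G y w u) - chern G y w (chern G y v u))) := rfl

/-- The Hessian `D(du)` of a function `u`. -/
def hess (G : E → E →L[ℝ] E →L[ℝ] ℝ) (u : E → ℝ) (y : E) : E →L[ℝ] E →L[ℝ] ℝ :=
  fderiv ℝ (fderiv ℝ u) y -
    (ContinuousLinearMap.compL ℝ E E ℝ (fderiv ℝ u y)) ∘L leviCivita G y

lemma hess_apply (G : E → E →L[ℝ] E →L[ℝ] ℝ) (u : E → ℝ) (y v w : E) :
    hess G u y v w = fderiv ℝ (fderiv ℝ u) y v w - fderiv ℝ u y (leviCivita G y v w) := rfl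

variable [FiniteDimensional ℂ E]

/-- The first Chern-Ricci form `S̃(v, w) = -tr^ℂ(J ∘ Ω(v, w))`. -/
def chernRicciForm (G : E → E →L[ℝ] E →L[ℝ] ℝ) (y : E) : E →L[ℝ] E →L[ℝ] ℝ :=
  -((ContinuousLinearMap.compL ℝ E (E →L[ℝ] E) ℝ
    (trCL E ∘L ContinuousLinearMap.compL ℝ E E E (cJ E))) ∘L chernCurv G y)

lemma chernRicciForm_apply (G : E → E →L[ℝ] E →L[ℝ] ℝ) (y v w : E) :
    chernRicciForm G y v w = -trC (cJ E ∘L chernCurv G y v w) := rfl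

/-- The Lee form `ϑ(v) = tr^ℝ(T(v, ·))`. -/
def leeFormAux (G : E → E →L[ℝ] E →L[ℝ] ℝ) (y : E) : E →L[ℝ] ℝ := trRL E ∘L chernTorsion G y

end Chart

/-! ### Complex manifolds -/

section Manifold

variable {E : Type*} [NormedAddCommGroup E] [NormedSpace ℂ E] {M : Type*} [TopologicalSpace M]
  [ChartedSpace E M]

/-- A complex manifold is a smooth real manifold. -/
instance isManifoldReal [IsManifold 𝓘(ℂ, E) ω M] (n : ℕ∞ω) : IsManifold 𝓘(ℝ, E) n M := by
  refine isManifold_of_contDiffOn 𝓘(ℝ, E) n M fun e e' he he' => ?_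
  have h := (contDiffGroupoid ω 𝓘(ℂ, E)).compatible he he'
  rw [contDiffGroupoid, mem_groupoid_of_pregroupoid] at h
  exact ((h.1 : ContDiffOn ℂ ω _ _).restrict_scalars ℝ).of_le le_top

/-- The complex structure `J` on the real tangent space `T_x M`, which is identified with `E` by
the preferred holomorphic chart at `x`. -/
def tangentJ (x : M) : TangentSpace 𝓘(ℝ, E) x →L[ℝ] TangentSpace 𝓘(ℝ, E) x := cJ E

/-- A smooth Hermitian metric on the complex manifold `M`: a smooth `J`-invariant Riemannian
metric. -/
structure HermitianMetric (E : Type*) [NormedAddCommGroup E] [NormedSpace ℂ E] (M : Type*)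
    [TopologicalSpace M] [ChartedSpace E M] [IsManifold 𝓘(ℂ, E) ω M] extends
    ContMDiffRiemannianMetric 𝓘(ℝ, E) ∞ E (fun x : M => TangentSpace 𝓘(ℝ, E) x) where
  hermitian : ∀ (x : M) (v w : TangentSpace 𝓘(ℝ, E) x),
    inner x (tangentJ x v) (tangentJ x w) = inner x v w

/-- The smooth sections of `End(TM)`. -/
abbrev SmoothEnd (E : Type*) [NormedAddCommGroup E] [NormedSpace ℂ E] (M : Type*)
    [TopologicalSpace M] [ChartedSpace E M] [IsManifold 𝓘(ℂ, E) ω M] :=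
  ContMDiffSection 𝓘(ℝ, E) (E →L[ℝ] E) ∞
    (fun x : M => TangentSpace 𝓘(ℝ, E) x →L[ℝ] TangentSpace 𝓘(ℝ, E) x)

variable [IsManifold 𝓘(ℂ, E) ω M]

/-- `h` is a section of `Sym^{1,1}(TM)`: symmetric for `g`, commuting with `J`. -/
structure IsSym11 (g : HermitianMetric E M) (h : SmoothEnd E M) : Prop where
  symm : ∀ (x : M) (v w : TangentSpace 𝓘(ℝ, E) x), g.inner x (h x v) w = g.inner x v (h x w)
  comm : ∀ (x : M) (v : TangentSpace 𝓘(ℝ, E) x), h x (tangentJ x v) = tangentJ x (h x v)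

/-- The scalar product of `g` on `T_x M`, as a bilinear form on `E`. -/
def metricAt (g : HermitianMetric E M) (x : M) : E →L[ℝ] E →L[ℝ] ℝ := g.inner x

/-- The components of `g` in the preferred chart `φ` at `x`, that is `(φ⁻¹)^* g`. -/
def inChart (g : HermitianMetric E M) (x : M) (y : E) : E →L[ℝ] E →L[ℝ] ℝ :=
  (metricAt g ((chartAt E x).symm y)).bilinearComp
    (mfderiv 𝓘(ℝ, E) 𝓘(ℝ, E) (chartAt E x).symm y : E →L[ℝ] E)
    (mfderiv 𝓘(ℝ, E) 𝓘(ℝ, E) (chartAt E x).symm y : E →L[ℝ] E)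

variable [FiniteDimensional ℂ E]

/-- The first Chern-Ricci symmetric endomorphism `S(g) = ρ_g⁻¹(S̃(g))`. -/
def chernRicci (g : HermitianMetric E M) (x : M) :
    TangentSpace 𝓘(ℝ, E) x →L[ℝ] TangentSpace 𝓘(ℝ, E) x :=
  (rhoInv (metricAt g x) (chernRicciForm (inChart g x) (chartAt E x x)) : E →L[ℝ] E)

/-- The Chern-scalar curvature `scal^Ch(g) = 2 Tr^ℂ_g(S̃(g))`. -/
def scalCh (g : HermitianMetric E M) (x : M) : ℝ :=
  2 * TrC (metricAt g x) (chernRicciForm (inChart g x) (chartAt E x x))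

/-- The Lee form `ϑ`. -/
def leeForm (g : HermitianMetric E M) (x : M) : TangentSpace 𝓘(ℝ, E) x →L[ℝ] ℝ :=
  (leeFormAux (inChart g x) (chartAt E x x) : E →L[ℝ] ℝ)

/-- The (nonnegative) Laplace-Beltrami operator `Δ_g = (D^g)^* D^g` on functions, that is
`Δ_g u = -tr_g(D^g du)`. -/
def laplacian (g : HermitianMetric E M) (u : M → ℝ) (x : M) : ℝ :=
  -traceForm (metricAt g x) (hess (inChart g x) (u ∘ (chartAt E x).symm) (chartAt E x x))

/-- The differential `du` of a function. -/
def diff (u : M → ℝ) (x : M) : TangentSpace 𝓘(ℝ, E) x →L[ℝ] ℝ := mfderiv 𝓘(ℝ, E) 𝓘(ℝ, ℝ) u x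

/-- The scalar product `g(α, β)` of two covectors at `x`. -/
def metricCo (g : HermitianMetric E M) (x : M) (α β : TangentSpace 𝓘(ℝ, E) x →L[ℝ] ℝ) : ℝ :=
  coInner (E := E) (metricAt g x) α β

/-- The scalar product `g(A, C)` of two endomorphisms of the tangent space at `x`. -/
def metricEnd (g : HermitianMetric E M) (x : M)
    (A C : TangentSpace 𝓘(ℝ, E) x →L[ℝ] TangentSpace 𝓘(ℝ, E) x) : ℝ :=
  endInner (E := E) (metricAt g x) A C

/-- The function `tr^ℂ h`. -/
def trCEnd (h : SmoothEnd E M) (x : M) : ℝ := trC (E := E) (h x)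

end Manifold

end ChernScal

end

noncomputable section

namespace ChernScal

open ContinuousLinearMap

/-! ### Traces of endomorphisms of finite-dimensional real normed spaces -/

section Trace

variable {F F' : Type*} [NormedAddCommGroup F] [NormedSpace ℝ F] [FiniteDimensional ℝ F]
  [NormedAddCommGroup F'] [NormedSpace ℝ F'] [FiniteDimensional ℝ F']

/-! In a holomorphic chart the Chern-scalar curvature depends on the metric only through the
one-form `logDer G` = d log |det G|, where G is read as a map from E to its dual. The Chern
connection form θ has type (1,0) and commutes with J, so tr(J[θ, θ]) vanishes and the Chern-Ricci
form is a J-twisted Hessian of log |det G| (`chernRicciForm_eq`). Tracing against G gives the closed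
formula `chartScal`, namely -½ tr(G⁻¹ D²log |det G|) with the flat second derivative D² of the
chart; the same computation with an endomorphism C inserted (`traceL_rhoInv_comp`) yields both the
scalar curvature and g(h, S).

For G_t = G(Id + tA) the determinant is multiplicative, so d log |det G_t| = d log |det G| + t
tr((Id + tA)⁻¹ dA). The inverse of G_t contributes -A at first order, and `hasDerivAt_chartScal`
gives the derivative ½ tr(G⁻¹ D²log |det G| A) - ½ tr(G⁻¹ D² tr A). The first term is -g(h, S) by
`endInner_rhoInv`. In the second, tr A = 2 tr^ℂ h, and `neg_traceForm_hess_add_coInner` identifies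
the flat expression -tr(G⁻¹ D²u) with Δu + g(du, ϑ): the traced Levi-Civita Christoffel symbols are
exactly cancelled by the Lee form.

Globally, `chartScal` is invariant under holomorphic changes of coordinates (`chartScal_pullback`),
because log |det| of a holomorphic Jacobian is pluriharmonic. Hence one fixed chart computes the
curvature at all nearby points (`scalCh_eq`), which gives smoothness in (t, x). Compactness of M
supplies a bound |g(hv, v)| ≤ C g(v, v), and therefore a uniform ε. -/

/-- The trace as a continuous linear functional. -/
def traceL (F : Type*) [NormedAddCommGroup F] [NormedSpace ℝ F] [FiniteDimensional ℝ F] :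
    (F →L[ℝ] F) →L[ℝ] ℝ :=
  LinearMap.toContinuousLinearMap (LinearMap.trace ℝ F ∘ₗ ContinuousLinearMap.coeLM ℝ)

lemma traceL_apply (A : F →L[ℝ] F) : traceL F A = LinearMap.trace ℝ F (A : F →ₗ[ℝ] F) := rfl

lemma traceL_comp_comm (A : F →L[ℝ] F') (B : F' →L[ℝ] F) :
    traceL F (B ∘L A) = traceL F' (A ∘L B) :=
  LinearMap.trace_comp_comm' (A : F →ₗ[ℝ] F') (B : F' →ₗ[ℝ] F)

/-- Composition with `A` on the right. -/
def precompDual (A : F →L[ℝ] F') : (F' →L[ℝ] ℝ) →L[ℝ] (F →L[ℝ] ℝ) :=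
  (ContinuousLinearMap.compL ℝ F F' ℝ).flip A

omit [FiniteDimensional ℝ F] [FiniteDimensional ℝ F'] in
@[simp] lemma precompDual_apply (A : F →L[ℝ] F') (φ : F' →L[ℝ] ℝ) :
    precompDual A φ = φ ∘L A := rfl

lemma traceL_precompDual (A : F →L[ℝ] F) : traceL (F →L[ℝ] ℝ) (precompDual A) = traceL F A := by
  rw [traceL_apply, traceL_apply, ← LinearMap.trace_transpose' (A : F →ₗ[ℝ] F),
    ← LinearMap.trace_conj' (Module.Dual.transpose (R := ℝ) (A : F →ₗ[ℝ] F))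
      (LinearMap.toContinuousLinearMap : (F →ₗ[ℝ] ℝ) ≃ₗ[ℝ] (F →L[ℝ] ℝ))]
  congr 1

/-- A is G⁻¹ Bᵀ G, and neither transposition nor conjugation changes a trace. This is the device
behind every vanishing or equality of traces taken against the metric. -/
lemma traceL_eq_of_adjoint {G : F →L[ℝ] F →L[ℝ] ℝ} (hG : G.IsInvertible) {A B : F →L[ℝ] F}
    (h : ∀ v w, G (A v) w = G v (B w)) : traceL F A = traceL F B := by
  have h1 : A = G.inverse ∘L (precompDual B ∘L G) := by
    ext v
    have : G (A v) = precompDual B (G v) := by ext w; exact h v w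
    simp [← this, hG]
  rw [h1, traceL_comp_comm, ← traceL_precompDual B]
  congr 1
  ext φ : 1
  simp [hG]

/-- The two endomorphisms are adjoint to each other when G is symmetric. -/
lemma traceL_inverse_comp_flip {G : F →L[ℝ] F →L[ℝ] ℝ} (hG : G.IsInvertible)
    (hs : ∀ v w, G v w = G w v) (b : F →L[ℝ] F →L[ℝ] ℝ) :
    traceL F (G.inverse ∘L b.flip) = traceL F (G.inverse ∘L b) := by
  refine (traceL_eq_of_adjoint hG fun v w => ?_).symm
  rw [hs v]
  simp [hG]

end Trace

/-! ### The logarithmic derivative of a determinant -/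

section LogDer

variable {X F F' F'' : Type*} [NormedAddCommGroup X] [NormedSpace ℝ X]
  [NormedAddCommGroup F] [NormedSpace ℝ F] [FiniteDimensional ℝ F]
  [NormedAddCommGroup F'] [NormedSpace ℝ F'] [FiniteDimensional ℝ F']
  [NormedAddCommGroup F''] [NormedSpace ℝ F''] [FiniteDimensional ℝ F'']

/-- The one-form `v ↦ tr (M⁻¹ ∂_v M)`, that is `d log |det M|`. -/
def logDer (M : X → F →L[ℝ] F') (y : X) : X →L[ℝ] ℝ :=
  traceL F ∘L (ContinuousLinearMap.compL ℝ F F' F (M y).inverse) ∘L fderiv ℝ M y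

omit [FiniteDimensional ℝ F'] in
lemma logDer_apply (M : X → F →L[ℝ] F') (y v : X) :
    logDer M y v = traceL F ((M y).inverse ∘L fderiv ℝ M y v) := rfl

omit [FiniteDimensional ℝ F'] in
lemma contDiffAt_inverse {n : ℕ∞ω} {M : X → F →L[ℝ] F'} {y : X} (hM : ContDiffAt ℝ n M y)
    (hi : (M y).IsInvertible) : ContDiffAt ℝ n (fun z => (M z).inverse) y :=
  haveI : CompleteSpace F := FiniteDimensional.complete ℝ F
  ContDiffAt.comp y hi.contDiffAt_map_inverse hM

omit [NormedSpace ℝ X] [FiniteDimensional ℝ F'] in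
lemma eventually_isInvertible {M : X → F →L[ℝ] F'} {y : X} (hM : ContinuousAt M y)
    (hi : (M y).IsInvertible) : ∀ᶠ z in nhds y, (M z).IsInvertible := by
  have : CompleteSpace F := FiniteDimensional.complete ℝ F
  obtain ⟨e, he⟩ := hi
  have := hM.eventually (he ▸ ContinuousLinearEquiv.nhds e)
  filter_upwards [this] with z hz
  exact hz

-- Differentiate M⁻¹M = Id, which holds near y since invertibility is an open condition, and
-- evaluate on M⁻¹φ.
omit [FiniteDimensional ℝ F'] in
lemma fderiv_inverse_apply {M : X → F →L[ℝ] F'} {y : X} (hM : ContDiffAt ℝ 1 M y)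
    (hi : (M y).IsInvertible) (v : X) :
    fderiv ℝ (fun z => (M z).inverse) y v =
      -((M y).inverse ∘L (fderiv ℝ M y v ∘L (M y).inverse)) := by
  have h1 : (fun z => (M z).inverse ∘L M z) =ᶠ[nhds y] fun _ => ContinuousLinearMap.id ℝ F := by
    filter_upwards [eventually_isInvertible hM.continuousAt hi] with z hz
    simp [hz]
  have h2 := fderiv_clm_comp ((contDiffAt_inverse hM hi).differentiableAt one_ne_zero)
    (hM.differentiableAt one_ne_zero)
  rw [h1.fderiv_eq] at h2
  have h3 := DFunLike.congr_fun h2 v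
  simp at h3
  ext φ
  have h4 := DFunLike.congr_fun h3 ((M y).inverse φ)
  simp [hi] at h4
  simp
  exact eq_neg_of_add_eq_zero_right h4.symm

omit [FiniteDimensional ℝ F'] in
lemma contDiffAt_logDer {M : X → F →L[ℝ] F'} {y : X} (hM : ContDiffAt ℝ ∞ M y)
    (hi : (M y).IsInvertible) : ContDiffAt ℝ ∞ (logDer M) y := by
  have h1 := contDiffAt_inverse hM hi
  have h2 : ContDiffAt ℝ ∞ (fderiv ℝ M) y := hM.fderiv_right (by simp)
  have h3 : ContDiffAt ℝ ∞
    (fun z => (ContinuousLinearMap.compL ℝ F F' F (M z).inverse) ∘L fderiv ℝ M z) y :=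
    ((ContinuousLinearMap.contDiff _).contDiffAt.comp y h1).clm_comp h2
  exact contDiffAt_const.clm_comp h3

omit [FiniteDimensional ℝ F'] in
lemma fderiv_logDer_apply {M : X → F →L[ℝ] F'} {y : X} (hM : ContDiffAt ℝ ∞ M y)
    (hi : (M y).IsInvertible) (v w : X) :
    fderiv ℝ (logDer M) y v w =
      -traceL F ((M y).inverse ∘L fderiv ℝ M y v ∘L (M y).inverse ∘L fderiv ℝ M y w) +
        traceL F ((M y).inverse ∘L fderiv ℝ (fderiv ℝ M) y v w) := by
  have h1 : DifferentiableAt ℝ (fun z => (M z).inverse) y :=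
    (contDiffAt_inverse hM hi).differentiableAt (by simp)
  have h2 : ContDiffAt ℝ ∞ (fderiv ℝ M) y := hM.fderiv_right (by simp)
  have h2' : DifferentiableAt ℝ (fderiv ℝ M) y := h2.differentiableAt (by simp)
  have h0 : DifferentiableAt ℝ (logDer M) y := (contDiffAt_logDer hM hi).differentiableAt (by simp)
  have h3 : HasFDerivAt (fun z => fderiv ℝ M z w) ((fderiv ℝ (fderiv ℝ M) y).flip w) y := by
    simpa using! h2'.hasFDerivAt.clm_apply (hasFDerivAt_const w y)
  have h4 := (traceL F).hasFDerivAt.comp y (h1.hasFDerivAt.clm_comp h3)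
  have h5 : HasFDerivAt (fun z => logDer M z w) ((fderiv ℝ (logDer M) y).flip w) y := by
    simpa using! h0.hasFDerivAt.clm_apply (hasFDerivAt_const w y)
  have h6 := DFunLike.congr_fun (h5.unique h4) v
  have h7 : fderiv ℝ (fun z => (M z).inverse) y v = _ :=
    fderiv_inverse_apply (hM.of_le (by simp)) hi v
  simp [h7] at h6
  rw [h6, add_comm]
  rfl

-- Closedness of d log |det M|: the quadratic term is symmetric by cyclicity of the trace, the other
-- by symmetry of second derivatives.
omit [FiniteDimensional ℝ F'] in
lemma fderiv_logDer_symm {M : X → F →L[ℝ] F'} {y : X} (hM : ContDiffAt ℝ ∞ M y)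
    (hi : (M y).IsInvertible) (v w : X) :
    fderiv ℝ (logDer M) y v w = fderiv ℝ (logDer M) y w v := by
  have hs : IsSymmSndFDerivAt ℝ M y :=
    hM.isSymmSndFDerivAt (by simpa using! WithTop.coe_le_coe.2 (le_top (a := (2 : ℕ∞))))
  rw [fderiv_logDer_apply hM hi, fderiv_logDer_apply hM hi, hs v w]
  have := traceL_comp_comm ((M y).inverse ∘L fderiv ℝ M y w) ((M y).inverse ∘L fderiv ℝ M y v)
  simp only [comp_assoc] at this
  rw [this]

-- Multiplicativity of the determinant, in logarithmic form. It controls both the change of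
-- coordinates and the deformation of the metric.
omit [FiniteDimensional ℝ F''] in
lemma logDer_comp {N : X → F' →L[ℝ] F''} {M : X → F →L[ℝ] F'} {y : X}
    (hN : DifferentiableAt ℝ N y) (hM : DifferentiableAt ℝ M y)
    (hNi : (N y).IsInvertible) (hMi : (M y).IsInvertible) :
    logDer (fun z => N z ∘L M z) y = logDer N y + logDer M y := by
  ext v
  have hinv : (N y ∘L M y).inverse = (M y).inverse ∘L (N y).inverse := by
    obtain ⟨e, he⟩ := hNi
    obtain ⟨e', he'⟩ := hMi
    rw [← he, ← he', ContinuousLinearEquiv.comp_coe]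
    simp only [inverse_equiv]
    rfl
  have h1 : ((M y).inverse ∘L (N y).inverse) ∘L
      fderiv ℝ (fun z => N z ∘L M z) y v = (M y).inverse ∘L fderiv ℝ M y v +
        (M y).inverse ∘L (((N y).inverse ∘L fderiv ℝ N y v) ∘L M y) := by
    rw [fderiv_clm_comp hN hM]
    ext; simp [hNi]
  rw [logDer_apply, hinv, h1, map_add, traceL_comp_comm (_ ∘L M y), add_apply, logDer_apply,
    logDer_apply, add_comm]
  congr 2
  ext; simp [hMi]

omit [FiniteDimensional ℝ F'] in
lemma logDer_comp_map {Y : Type*} [NormedAddCommGroup Y] [NormedSpace ℝ Y]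
    {M : X → F →L[ℝ] F'} {ψ : Y → X} {y : Y} (hM : DifferentiableAt ℝ M (ψ y))
    (hψ : DifferentiableAt ℝ ψ y) :
    logDer (fun z => M (ψ z)) y = logDer M (ψ y) ∘L fderiv ℝ ψ y := by
  have : fderiv ℝ (fun z => M (ψ z)) y = _ := fderiv_comp y hM hψ
  ext v
  simp [logDer_apply, this]

omit [FiniteDimensional ℝ F] [FiniteDimensional ℝ F'] in
lemma isInvertible_precompDual {A : F →L[ℝ] F'} (hA : A.IsInvertible) :
    (precompDual A).IsInvertible ∧ (precompDual A).inverse = precompDual A.inverse := by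
  have h1 : Function.LeftInverse (precompDual A) (precompDual A.inverse) := fun φ => by
    ext; simp [hA]
  have h2 : Function.RightInverse (precompDual A) (precompDual A.inverse) := fun φ => by
    ext; simp [hA]
  have := inverse_eq (f := precompDual A) (g := precompDual A.inverse) (by ext; simp [hA])
    (by ext; simp [hA])
  refine ⟨⟨.equivOfInverse _ _ h2 h1, rfl⟩, this⟩

lemma logDer_precompDual {M : X → F →L[ℝ] F} {y : X} (hM : DifferentiableAt ℝ M y)
    (hi : (M y).IsInvertible) : logDer (fun z => precompDual (M z)) y = logDer M y := by
  ext v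
  have h1 : HasFDerivAt (fun z => precompDual (M z))
      ((ContinuousLinearMap.compL ℝ F F ℝ).flip ∘L fderiv ℝ M y) y :=
    HasFDerivAt.comp (g := (ContinuousLinearMap.compL ℝ F F ℝ).flip) (f := M) y
      (ContinuousLinearMap.hasFDerivAt _) hM.hasFDerivAt
  rw [logDer_apply, h1.fderiv, (isInvertible_precompDual hi).2, logDer_apply]
  exact (traceL_precompDual (fderiv ℝ M y v ∘L (M y).inverse)).trans (traceL_comp_comm _ _)

end LogDer

/-! ### Hermitian metrics on an open subset of `E` -/

section HermitianChart

variable {E : Type*} [NormedAddCommGroup E] [NormedSpace ℂ E]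

lemma cJ_cJ (v : E) : cJ E (cJ E v) = -v := by simp [smul_smul]

/-- `G` is a smooth nondegenerate `J`-invariant symmetric bilinear form on the open set `U`. -/
structure IsHermitianOn (G : E → E →L[ℝ] E →L[ℝ] ℝ) (U : Set E) : Prop where
  isOpen : IsOpen U
  contDiffOn : ContDiffOn ℝ ∞ G U
  symm : ∀ z ∈ U, ∀ v w, G z v w = G z w v
  herm : ∀ z ∈ U, ∀ v w, G z (cJ E v) (cJ E w) = G z v w
  isInvertible : ∀ z ∈ U, (G z).IsInvertible

namespace IsHermitianOn

variable {G : E → E →L[ℝ] E →L[ℝ] ℝ} {U : Set E} (hG : IsHermitianOn G U) {y : E} (hy : y ∈ U)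
include hG hy

lemma mem_nhds : U ∈ nhds y := hG.isOpen.mem_nhds hy

lemma contDiffAt : ContDiffAt ℝ ∞ G y := hG.contDiffOn.contDiffAt (hG.mem_nhds hy)

lemma differentiableAt : DifferentiableAt ℝ G y := (hG.contDiffAt hy).differentiableAt (by simp)

lemma hasFDerivAt_apply₂ (w u : E) :
    HasFDerivAt (fun z => G z w u) (((fderiv ℝ G y).flip w).flip u) y := by
  have h1 : HasFDerivAt (fun z => G z w) ((fderiv ℝ G y).flip w) y := by
    simpa using! (hG.differentiableAt hy).hasFDerivAt.clm_apply (hasFDerivAt_const w y)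
  simpa using! h1.clm_apply (hasFDerivAt_const u y)

lemma fderiv_symm (v w u : E) : fderiv ℝ G y v w u = fderiv ℝ G y v u w := by
  have h : (fun z => G z w u) =ᶠ[nhds y] fun z => G z u w := by
    filter_upwards [hG.mem_nhds hy] with z hz using hG.symm z hz w u
  exact DFunLike.congr_fun
    ((hG.hasFDerivAt_apply₂ hy w u).unique ((hG.hasFDerivAt_apply₂ hy u w).congr_of_eventuallyEq h)) v

lemma fderiv_herm (v w u : E) : fderiv ℝ G y v (cJ E w) (cJ E u) = fderiv ℝ G y v w u := by
  have h : (fun z => G z w u) =ᶠ[nhds y] fun z => G z (cJ E w) (cJ E u) := by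
    filter_upwards [hG.mem_nhds hy] with z hz using (hG.herm z hz w u).symm
  exact DFunLike.congr_fun
    (((hG.hasFDerivAt_apply₂ hy _ _).congr_of_eventuallyEq h).unique (hG.hasFDerivAt_apply₂ hy w u)) v

lemma skew (v w : E) : G y (cJ E v) w = -G y v (cJ E w) := by
  rw [← hG.herm y hy, cJ_cJ]; simp

lemma fderiv_skew (v w u : E) : fderiv ℝ G y v (cJ E w) u = -fderiv ℝ G y v w (cJ E u) := by
  rw [← hG.fderiv_herm hy, cJ_cJ]; simp

lemma fderiv_fundForm (v w u : E) :
    fderiv ℝ (fundForm G) y v w u = fderiv ℝ G y v (cJ E w) u := by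
  have h : HasFDerivAt (fundForm G) _ y :=
    (hG.differentiableAt hy).hasFDerivAt.clm_comp (hasFDerivAt_const (cJ E) y)
  rw [h.fderiv]
  simp

/-- In dω(Jv, w, u), J-invariance of G turns the w- and u-derivatives into ∂_w G(u, v) and -∂_u G(v,
w), which cancel the corresponding Levi-Civita terms. What survives is the (1,0) part of ∂G, the
usual formula θ = H⁻¹∂H. -/
lemma chernLow_eq (v w u : E) :
    chernLow G y v w u = 2⁻¹ * (fderiv ℝ G y v w u - fderiv ℝ G y (cJ E v) (cJ E w) u) := by
  rw [chernLow_apply, leviCivitaLow_apply, dFundForm_apply, hG.fderiv_fundForm hy,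
    hG.fderiv_fundForm hy, hG.fderiv_fundForm hy, hG.fderiv_herm hy w, cJ_cJ, hG.fderiv_symm hy w v]
  simp
  ring

lemma sharp_apply (φ : E →L[ℝ] ℝ) (w : E) : G y ((G y).inverse φ) w = φ w := by
  simp [hG.isInvertible y hy]

lemma ext_iff_apply {v w : E} : v = w ↔ ∀ u, G y v u = G y w u :=
  ⟨fun h _ => h ▸ rfl, fun h => (hG.isInvertible y hy).bijective.injective (by ext u; exact h u)⟩

lemma apply_chern (v w u : E) : G y (chern G y v w) u = chernLow G y v w u := by
  exact hG.sharp_apply hy _ u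

lemma chern_commute (v w : E) : chern G y v (cJ E w) = cJ E (chern G y v w) := by
  rw [hG.ext_iff_apply hy]
  intro u
  rw [hG.skew hy, hG.apply_chern hy, hG.apply_chern hy, hG.chernLow_eq hy, hG.chernLow_eq hy,
    cJ_cJ, hG.fderiv_herm hy, hG.fderiv_skew hy v]
  simp
  ring

lemma inverse_comp_cJ (φ : E →L[ℝ] ℝ) :
    (G y).inverse (φ ∘L cJ E) = -cJ E ((G y).inverse φ) := by
  rw [hG.ext_iff_apply hy]
  intro u
  rw [hG.sharp_apply hy, map_neg, neg_apply, hG.skew hy, hG.sharp_apply hy]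
  simp

lemma chern_eq (v : E) :
    chern G y v = (2⁻¹ : ℝ) • ((G y).inverse ∘L fderiv ℝ G y v -
      ((G y).inverse ∘L fderiv ℝ G y (cJ E v)) ∘L cJ E) := by
  ext w
  rw [hG.ext_iff_apply hy]
  intro u
  rw [hG.apply_chern hy, hG.chernLow_eq hy]
  simp [hG.isInvertible y hy]

end IsHermitianOn

/-! ### Ricci form, Lee form and Laplacian expressed through `logDer G`. -/

variable [FiniteDimensional ℂ E]

/-- Compare the diagonals in a complex basis (bᵢ) and in the real basis (bᵢ, i bᵢ). No commutation
with J is needed, since the antilinear part of A has real trace zero. -/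
lemma trC_eq (A : E →L[ℝ] E) : trC A = 2⁻¹ * traceL E A := by
  classical
  set b := Module.finBasis ℂ E
  rw [traceL_apply, trC, LinearMap.trace_eq_matrix_trace ℂ b,
    LinearMap.trace_eq_matrix_trace ℝ (Complex.basisOneI.smulTower b), Matrix.trace, Matrix.trace,
    Fintype.sum_prod_type, Finset.sum_comm, Finset.mul_sum, Complex.re_sum]
  refine Finset.sum_congr rfl fun i _ => ?_
  have h : complexPart A (b i) = (2⁻¹ : ℂ) • (A (b i) - Complex.I • A (Complex.I • b i)) := by
    change (2⁻¹ : ℝ) • (A (b i) - cJ E (A (cJ E (b i)))) = _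
    rw [← Complex.coe_smul]
    simp
  simp [LinearMap.toMatrix_apply, h, Module.Basis.smulTower_apply, Module.Basis.smulTower_repr]

/-- The Chern-scalar curvature `-½ tr_G (∂² log det G)` in a chart. -/
def chartScal (G : E → E →L[ℝ] E →L[ℝ] ℝ) (y : E) : ℝ :=
  -(2⁻¹ * traceL E ((G y).inverse ∘L fderiv ℝ (logDer G) y))

namespace IsHermitianOn

variable {G : E → E →L[ℝ] E →L[ℝ] ℝ} {U : Set E} (hG : IsHermitianOn G U) {y : E} (hy : y ∈ U)
include hG

lemma contDiffOn_chern : ContDiffOn ℝ ∞ (chern G) U := by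
  have hD : ContDiffOn ℝ ∞ (fderiv ℝ G) U := hG.contDiffOn.fderiv_of_isOpen hG.isOpen (by simp)
  refine contDiffOn_clm_apply.2 fun v => contDiffOn_clm_apply.2 fun w => ?_
  have h1 : ContDiffOn ℝ ∞ (fun z => chernLow G z v w) U := by
    refine contDiffOn_clm_apply.2 fun u => ContDiffOn.congr
      (f := fun z => 2⁻¹ * (fderiv ℝ G z v w u - fderiv ℝ G z (cJ E v) (cJ E w) u)) ?_
      fun z hz => hG.chernLow_eq hz v w u
    exact contDiffOn_const.mul
      ((((hD.clm_apply contDiffOn_const).clm_apply contDiffOn_const).clm_apply contDiffOn_const).sub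
      (((hD.clm_apply contDiffOn_const).clm_apply contDiffOn_const).clm_apply contDiffOn_const))
  have h2 : ContDiffOn ℝ ∞ (fun z => (G z).inverse) U := fun z hz =>
    (contDiffAt_inverse (hG.contDiffAt hz) (hG.isInvertible z hz)).contDiffWithinAt
  exact h2.clm_apply h1

include hy

/-- G⁻¹∂_vG is G-symmetric and J is G-skew, so the adjoint of J G⁻¹∂_vG is -G⁻¹∂_vG J; by cyclicity
the trace equals its own opposite. -/
lemma traceL_cJ_comp (v : E) :
    traceL E (cJ E ∘L (G y).inverse ∘L fderiv ℝ G y v) = 0 := by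
  have h := traceL_eq_of_adjoint (hG.isInvertible y hy)
    (A := cJ E ∘L (G y).inverse ∘L fderiv ℝ G y v)
    (B := -(((G y).inverse ∘L fderiv ℝ G y v) ∘L cJ E)) fun w u => by
      rw [hG.symm y hy w]
      simp only [comp_apply, neg_apply, map_neg]
      rw [hG.skew hy, hG.sharp_apply hy, hG.sharp_apply hy, hG.fderiv_symm hy]
  rw [map_neg, traceL_comp_comm _ (cJ E)] at h
  rw [traceL_comp_comm]
  linarith

lemma traceL_cJ_chern (v : E) :
    traceL E (cJ E ∘L chern G y v) = 2⁻¹ * logDer G y (cJ E v) := by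
  rw [hG.chern_eq hy, comp_smul, map_smul, comp_sub, map_sub, hG.traceL_cJ_comp hy, logDer_apply,
    ← comp_assoc, traceL_comp_comm]
  have : cJ E ∘L cJ E ∘L (G y).inverse ∘L fderiv ℝ G y (cJ E v) =
      -((G y).inverse ∘L fderiv ℝ G y (cJ E v)) := by
    ext; simp only [comp_apply, cJ_cJ, neg_apply]
  rw [this]
  simp

lemma traceL_cJ_fderiv_chern (v w : E) :
    traceL E (cJ E ∘L fderiv ℝ (chern G) y v w) = 2⁻¹ * fderiv ℝ (logDer G) y v (cJ E w) := by
  have h1 : DifferentiableAt ℝ (chern G) y :=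
    (hG.contDiffOn_chern.contDiffAt (hG.mem_nhds hy)).differentiableAt (by simp)
  have h2 : DifferentiableAt ℝ (logDer G) y :=
    (contDiffAt_logDer (hG.contDiffAt hy) (hG.isInvertible y hy)).differentiableAt (by simp)
  have h3 : HasFDerivAt (fun z => chern G z w) ((fderiv ℝ (chern G) y).flip w) y := by
    simpa using! h1.hasFDerivAt.clm_apply (hasFDerivAt_const w y)
  have h4 : HasFDerivAt (fun z => logDer G z (cJ E w)) ((fderiv ℝ (logDer G) y).flip (cJ E w)) y := by
    simpa using! h2.hasFDerivAt.clm_apply (hasFDerivAt_const (cJ E w) y)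
  have h5 := (traceL E ∘L ContinuousLinearMap.compL ℝ E E E (cJ E)).hasFDerivAt.comp y h3
  have h6 : (fun z => 2⁻¹ * logDer G z (cJ E w)) =ᶠ[nhds y]
      (traceL E ∘L ContinuousLinearMap.compL ℝ E E E (cJ E)) ∘ fun z => chern G z w := by
    filter_upwards [hG.mem_nhds hy] with z hz
    exact (hG.traceL_cJ_chern hz w).symm
  exact DFunLike.congr_fun ((h5.congr_of_eventuallyEq h6).unique (h4.const_mul 2⁻¹)) v

/-- θ commutes with J, so the quadratic part of the curvature is traceless after composition with J.
The rest is the exterior derivative of tr(Jθ) = ½ d log |det G| ∘ J, and closedness of `logDer G`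
puts it in this form. -/
lemma chernRicciForm_eq (v w : E) :
    chernRicciForm G y v w =
      4⁻¹ * (fderiv ℝ (logDer G) y v (cJ E w) - fderiv ℝ (logDer G) y (cJ E v) w) := by
  have h1 : cJ E ∘L chernCurv G y v w =
      -(cJ E ∘L fderiv ℝ (chern G) y v w - cJ E ∘L fderiv ℝ (chern G) y w v +
        ((cJ E ∘L chern G y v) ∘L chern G y w - cJ E ∘L (chern G y w ∘L chern G y v))) := by
    ext u
    simp only [comp_apply, chernCurv_apply, neg_apply, add_apply, sub_apply, map_neg, map_add,
      map_sub]
  have h2 : traceL E (cJ E ∘L (chern G y w ∘L chern G y v)) =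
      traceL E ((cJ E ∘L chern G y v) ∘L chern G y w) := by
    have : (cJ E ∘L chern G y v) ∘L chern G y w = (chern G y v ∘L cJ E) ∘L chern G y w := by
      ext u
      simp only [comp_apply, hG.chern_commute hy]
    rw [this, ← comp_assoc, traceL_comp_comm, comp_assoc]
  have h3 := fderiv_logDer_symm (hG.contDiffAt hy) (hG.isInvertible y hy) w (cJ E v)
  rw [chernRicciForm_apply, trC_eq, h1, map_neg, map_add, map_sub, map_sub, h2,
    hG.traceL_cJ_fderiv_chern hy, hG.traceL_cJ_fderiv_chern hy, h3]
  ring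

/-- With N = G⁻¹ D²log |det G|, the endomorphism S is -¼(N - JNJ), and against a C commuting with J
both halves have the same trace. C = Id gives the scalar curvature, C = h the term g(h, S). -/
lemma traceL_rhoInv_comp {C : E →L[ℝ] E} (hC : ∀ v, C (cJ E v) = cJ E (C v)) :
    traceL E (rhoInv (G y) (chernRicciForm G y) ∘L C) =
      -(2⁻¹ * traceL E ((G y).inverse ∘L fderiv ℝ (logDer G) y ∘L C)) := by
  set N := (G y).inverse ∘L fderiv ℝ (logDer G) y with hN
  have h1 : rhoInv (G y) (chernRicciForm G y) ∘L C =
      -((4⁻¹ : ℝ) • (N ∘L C - cJ E ∘L ((N ∘L C) ∘L cJ E))) := by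
    ext v
    have h2 : chernRicciForm G y (C v) = (4⁻¹ : ℝ) • (fderiv ℝ (logDer G) y (C v) ∘L cJ E -
        fderiv ℝ (logDer G) y (cJ E (C v))) := by
      ext w; simp only [hG.chernRicciForm_eq hy, smul_apply, sub_apply, comp_apply, smul_eq_mul]
    change -(cJ E ((G y).inverse (chernRicciForm G y (C v)))) = _
    rw [h2, map_smul, map_sub, hG.inverse_comp_cJ hy, map_smul, map_sub, map_neg, cJ_cJ, neg_neg]
    simp only [neg_apply, smul_apply, sub_apply, comp_apply, hC, hN]
  have h2 : traceL E (cJ E ∘L ((N ∘L C) ∘L cJ E)) = -traceL E (N ∘L C) := by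
    rw [traceL_comp_comm, comp_assoc, ← map_neg]
    congr 1
    ext v; simp only [comp_apply, cJ_cJ, neg_apply, map_neg]
  rw [h1, map_neg, map_smul, map_sub, h2, ← comp_assoc, smul_eq_mul]
  ring

lemma two_mul_TrC_chernRicciForm :
    2 * TrC (G y) (chernRicciForm G y) = chartScal G y := by
  have := hG.traceL_rhoInv_comp hy (C := ContinuousLinearMap.id ℝ E) fun _ => rfl
  simp only [comp_id] at this
  rw [TrC, trC_eq, this, chartScal]
  ring

lemma endInner_rhoInv {C : E →L[ℝ] E} (hC : ∀ v, C (cJ E v) = cJ E (C v))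
    (hCs : ∀ v w, G y (C v) w = G y v (C w)) :
    endInner (G y) C (rhoInv (G y) (chernRicciForm G y)) =
      -(2⁻¹ * traceL E ((G y).inverse ∘L fderiv ℝ (logDer G) y ∘L C)) := by
  rw [← hG.traceL_rhoInv_comp hy hC, traceL_comp_comm]
  -- The endomorphism traced by `endInner` is S*C, whose adjoint is CS because C is symmetric;
  -- symmetry of S is not needed.
  refine traceL_eq_of_adjoint (hG.isInvertible y hy) fun v w => ?_
  exact (hG.sharp_apply hy _ w).trans (hCs _ _)

/-- Expand the torsion with `chern_eq`: the J-twisted half of θ(X) is traceless by `traceL_cJ_comp`,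
and the two halves of θ(·)X contribute equally. -/
lemma leeFormAux_eq (X : E) :
    leeFormAux G y X = 2⁻¹ * logDer G y X -
      traceL E ((G y).inverse ∘L (fderiv ℝ G y).flip X) := by
  set N := (G y).inverse ∘L (fderiv ℝ G y).flip X with hN
  have h1 : chernTorsion G y X = (2⁻¹ : ℝ) • ((G y).inverse ∘L fderiv ℝ G y X -
      ((G y).inverse ∘L fderiv ℝ G y (cJ E X)) ∘L cJ E - N + cJ E ∘L (N ∘L cJ E)) := by
    ext w
    have h2 : fderiv ℝ G y (cJ E w) (cJ E X) = -(fderiv ℝ G y (cJ E w) X ∘L cJ E) := by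
      ext u; simp only [hG.fderiv_skew hy, neg_apply, comp_apply]
    rw [chernTorsion_apply, hG.chern_eq hy, hG.chern_eq hy]
    simp only [smul_apply, sub_apply, add_apply, comp_apply, hN, flip_apply, h2, map_neg,
      hG.inverse_comp_cJ hy]
    module
  have h2 : traceL E (cJ E ∘L (N ∘L cJ E)) = -traceL E N := by
    rw [traceL_comp_comm, comp_assoc, ← map_neg]
    congr 1
    ext v; simp only [comp_apply, cJ_cJ, neg_apply, map_neg]
  change traceL E (chernTorsion G y X) = _
  rw [h1, map_smul, map_add, map_sub, map_sub, h2, traceL_comp_comm (cJ E),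
    hG.traceL_cJ_comp hy, logDer_apply, smul_eq_mul]
  ring

/-- Set X = grad u. The Christoffel part of the Hessian has trace tr(G⁻¹ ∂_•G(X, ·)) - ½ d log |det
G|(X), which is -ϑ(X) by `leeFormAux_eq`; adding g(du, ϑ) = ϑ(X) leaves only the flat second
derivative. -/
lemma neg_traceForm_hess_add_coInner (u : E → ℝ) :
    -traceForm (G y) (hess G u y) + coInner (G y) (fderiv ℝ u y) (leeFormAux G y) =
      -traceL E ((G y).inverse ∘L fderiv ℝ (fderiv ℝ u) y) := by
  set X := (G y).inverse (fderiv ℝ u y) with hX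
  have h1 : coInner (G y) (fderiv ℝ u y) (leeFormAux G y) = leeFormAux G y X := by
    change G y X ((G y).inverse _) = _
    rw [hG.symm y hy, hG.sharp_apply hy]
  have h2 : hess G u y = fderiv ℝ (fderiv ℝ u) y - (2⁻¹ : ℝ) • ((fderiv ℝ G y).flip X +
      ((fderiv ℝ G y).flip X).flip - fderiv ℝ G y X) := by
    ext v w
    have h3 : fderiv ℝ u y (leviCivita G y v w) = leviCivitaLow G y v w X := by
      rw [← hG.sharp_apply hy (fderiv ℝ u y), hG.symm y hy]
      exact hG.sharp_apply hy _ _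
    rw [hess_apply, h3, leviCivitaLow_apply]
    simp only [sub_apply, smul_apply, add_apply, flip_apply, smul_eq_mul,
      hG.fderiv_symm hy _ X]
  have h3 : traceForm (G y) (hess G u y) = traceL E ((G y).inverse ∘L fderiv ℝ (fderiv ℝ u) y) -
      (2⁻¹ : ℝ) * (traceL E ((G y).inverse ∘L (fderiv ℝ G y).flip X) +
        traceL E ((G y).inverse ∘L ((fderiv ℝ G y).flip X).flip) - logDer G y X) := by
    change traceL E ((G y).inverse ∘L _) = _
    rw [h2, comp_sub, comp_smul, comp_sub, comp_add, map_sub, map_smul, map_sub, map_add,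
      logDer_apply, smul_eq_mul]
  rw [h1, h3, traceL_inverse_comp_flip (hG.isInvertible y hy) (hG.symm y hy),
    hG.leeFormAux_eq hy]
  ring

end IsHermitianOn

end HermitianChart

/-! ### Properties of the chart formula `chartScal`. -/

section ChartScal

variable {E : Type*} [NormedAddCommGroup E] [NormedSpace ℂ E]

lemma IsHermitianOn.mono {G : E → E →L[ℝ] E →L[ℝ] ℝ} {U V : Set E} (hG : IsHermitianOn G U)
    (hV : IsOpen V) (h : V ⊆ U) : IsHermitianOn G V where
  isOpen := hV
  contDiffOn := hG.contDiffOn.mono h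
  symm z hz := hG.symm z (h hz)
  herm z hz := hG.herm z (h hz)
  isInvertible z hz := hG.isInvertible z (h hz)

variable [FiniteDimensional ℂ E]

lemma logDer_congr {M N : E → E →L[ℝ] E →L[ℝ] ℝ} {y : E} (h : M =ᶠ[nhds y] N) :
    logDer M y = logDer N y := by
  ext v
  rw [logDer_apply, logDer_apply, h.eq_of_nhds, h.fderiv_eq]

lemma chartScal_congr {G H : E → E →L[ℝ] E →L[ℝ] ℝ} {y : E} (h : G =ᶠ[nhds y] H) :
    chartScal G y = chartScal H y := by
  have h1 : logDer G =ᶠ[nhds y] logDer H := by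
    filter_upwards [h.eventuallyEq_nhds] with z hz using logDer_congr hz
  rw [chartScal, chartScal, h1.fderiv_eq, h.eq_of_nhds]

/-! ### Invariance under holomorphic coordinate changes -/

section Pullback

variable {G H : E → E →L[ℝ] E →L[ℝ] ℝ} {U V : Set E} {ψ : E → E}

/-- For L = dψ with ψ holomorphic, log |det L| is pluriharmonic. Complex linearity of L together
with the symmetry `hs` of its derivative lets J pass from either argument to the values, so
replacing v, w by Jv, Jw produces J² = -1 in both terms of `fderiv_logDer_apply`. -/
lemma fderiv_logDer_anti {L : E → E →L[ℝ] E} (hV : IsOpen V) (hL : ContDiffOn ℝ ∞ L V)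
    (hLi : ∀ z ∈ V, (L z).IsInvertible) (hLJ : ∀ z ∈ V, ∀ v, L z (cJ E v) = cJ E (L z v))
    {y : E} (hy : y ∈ V) (hs : ∀ z ∈ V, ∀ v w, fderiv ℝ L z v w = fderiv ℝ L z w v) (v w : E) :
    fderiv ℝ L y (cJ E v) w = cJ E (fderiv ℝ L y v w) ∧
    fderiv ℝ (logDer L) y (cJ E v) (cJ E w) = -fderiv ℝ (logDer L) y v w := by
  have hLy : ContDiffAt ℝ ∞ L y := hL.contDiffAt (hV.mem_nhds hy)
  have hLd : ∀ z ∈ V, DifferentiableAt ℝ L z := fun z hz =>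
    (hL.contDiffAt (hV.mem_nhds hz)).differentiableAt (by simp)
  have h1 : ∀ z ∈ V, ∀ v w, fderiv ℝ L z v (cJ E w) = cJ E (fderiv ℝ L z v w) := by
    intro z hz v w
    have e1 : HasFDerivAt (fun z => L z (cJ E w)) ((fderiv ℝ L z).flip (cJ E w)) z := by
      simpa using! (hLd z hz).hasFDerivAt.clm_apply (hasFDerivAt_const (cJ E w) z)
    have e2 : HasFDerivAt (fun z => L z w) ((fderiv ℝ L z).flip w) z := by
      simpa using! (hLd z hz).hasFDerivAt.clm_apply (hasFDerivAt_const w z)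
    have e3 := (cJ E).hasFDerivAt.comp z e2
    have e4 : (fun z => L z (cJ E w)) =ᶠ[nhds z] (cJ E) ∘ fun z => L z w := by
      filter_upwards [hV.mem_nhds hz] with x hx using hLJ x hx w
    exact DFunLike.congr_fun (e1.unique (e3.congr_of_eventuallyEq e4)) v
  have h2 : ∀ z ∈ V, ∀ w, fderiv ℝ L z (cJ E w) = cJ E ∘L fderiv ℝ L z w := by
    intro z hz w
    ext u
    rw [hs z hz, h1 z hz, hs z hz]; rfl
  refine ⟨by rw [h2 y hy]; rfl, ?_⟩
  have hD : ContDiffAt ℝ ∞ (fderiv ℝ L) y := hLy.fderiv_right (by simp)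
  have hDd : DifferentiableAt ℝ (fderiv ℝ L) y := hD.differentiableAt (by simp)
  have h3 : ∀ v w, fderiv ℝ (fderiv ℝ L) y v (cJ E w) = cJ E ∘L fderiv ℝ (fderiv ℝ L) y v w := by
    intro v w
    have e1 : HasFDerivAt (fun z => fderiv ℝ L z (cJ E w))
        ((fderiv ℝ (fderiv ℝ L) y).flip (cJ E w)) y := by
      simpa using! hDd.hasFDerivAt.clm_apply (hasFDerivAt_const (cJ E w) y)
    have e2 : HasFDerivAt (fun z => fderiv ℝ L z w) ((fderiv ℝ (fderiv ℝ L) y).flip w) y := by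
      simpa using! hDd.hasFDerivAt.clm_apply (hasFDerivAt_const w y)
    have e3 := (ContinuousLinearMap.compL ℝ E E E (cJ E)).hasFDerivAt.comp y e2
    have e4 : (fun z => fderiv ℝ L z (cJ E w)) =ᶠ[nhds y]
        (ContinuousLinearMap.compL ℝ E E E (cJ E)) ∘ fun z => fderiv ℝ L z w := by
      filter_upwards [hV.mem_nhds hy] with x hx using h2 x hx w
    exact DFunLike.congr_fun (e1.unique (e3.congr_of_eventuallyEq e4)) v
  have hss : IsSymmSndFDerivAt ℝ L y :=
    hLy.isSymmSndFDerivAt (by simpa using! WithTop.coe_le_coe.2 (le_top (a := (2 : ℕ∞))))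
  have h4 : fderiv ℝ (fderiv ℝ L) y (cJ E v) (cJ E w) = -fderiv ℝ (fderiv ℝ L) y v w := by
    rw [h3, hss (cJ E v) w, h3, hss w v]
    ext u
    simp only [comp_apply, cJ_cJ, neg_apply]
  have h5 : ∀ u, (L y).inverse (cJ E u) = cJ E ((L y).inverse u) := by
    intro u
    apply (hLi y hy).bijective.injective
    rw [hLJ y hy]
    simp [hLi y hy]
  rw [fderiv_logDer_apply hLy (hLi y hy), fderiv_logDer_apply hLy (hLi y hy), h4, h2 y hy, h2 y hy,
    comp_neg, map_neg, neg_add, neg_neg]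
  congr 1
  rw [neg_eq_iff_eq_neg, ← map_neg]
  have h6 : ∀ u, fderiv ℝ L y v (cJ E u) = cJ E (fderiv ℝ L y v u) := h1 y hy v
  congr 1
  ext u
  simp only [comp_apply, h5, h6, cJ_cJ, neg_apply, map_neg]

/-- The metric pulls back to Lᵀ(G∘ψ)L, so d log |det H| is the pullback of d log |det G| plus 2 d
log |det L|. After one more derivative the non-tensorial terms are J-anti-invariant, hence invisible
to the trace against a Hermitian metric. -/
lemma chartScal_pullback (hG : IsHermitianOn G U) (hH : IsHermitianOn H V)
    (hψ : ContDiffOn ℝ ∞ ψ V) (hm : Set.MapsTo ψ V U)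
    (hi : ∀ z ∈ V, (fderiv ℝ ψ z).IsInvertible)
    (hJ : ∀ z ∈ V, ∀ v, fderiv ℝ ψ z (cJ E v) = cJ E (fderiv ℝ ψ z v))
    (hHG : ∀ z ∈ V, H z = (G (ψ z)).bilinearComp (fderiv ℝ ψ z) (fderiv ℝ ψ z))
    {y : E} (hy : y ∈ V) : chartScal H y = chartScal G (ψ y) := by
  set L := fderiv ℝ ψ with hL
  have hψd : ∀ z ∈ V, ContDiffAt ℝ ∞ ψ z := fun z hz => hψ.contDiffAt (hH.mem_nhds hz)
  have hψ1 : ∀ z ∈ V, DifferentiableAt ℝ ψ z := fun z hz => (hψd z hz).differentiableAt (by simp)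
  have hLc : ContDiffOn ℝ ∞ L V := hψ.fderiv_of_isOpen hH.isOpen (by simp)
  have hLd : ∀ z ∈ V, DifferentiableAt ℝ L z := fun z hz =>
    (hLc.contDiffAt (hH.mem_nhds hz)).differentiableAt (by simp)
  have hs : ∀ z ∈ V, ∀ v w, fderiv ℝ L z v w = fderiv ℝ L z w v := fun z hz =>
    (hψd z hz).isSymmSndFDerivAt (by simpa using! WithTop.coe_le_coe.2 (le_top (a := (2 : ℕ∞))))
  have hH' : ∀ z ∈ V, H z = precompDual (L z) ∘L (G (ψ z) ∘L L z) := fun z hz => by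
    rw [hHG z hz]; ext v w; simp
  have hGi : ∀ z ∈ V, (G (ψ z)).IsInvertible := fun z hz => hG.isInvertible _ (hm hz)
  have hGd : ∀ z ∈ V, DifferentiableAt ℝ (fun z => G (ψ z)) z := fun z hz =>
    (hG.differentiableAt (hm hz)).comp z (hψ1 z hz)
  have hpd : ∀ z ∈ V, DifferentiableAt ℝ (fun z => precompDual (L z)) z := fun z hz =>
    DifferentiableAt.comp (g := (ContinuousLinearMap.compL ℝ E E ℝ).flip) (f := L) z
      (ContinuousLinearMap.differentiableAt _) (hLd z hz)
  have h1 : ∀ z ∈ V, logDer H z = logDer G (ψ z) ∘L L z + (2 : ℝ) • logDer L z := by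
    intro z hz
    have e : H =ᶠ[nhds z] fun z => precompDual (L z) ∘L (G (ψ z) ∘L L z) := by
      filter_upwards [hH.mem_nhds hz] with x hx using hH' x hx
    rw [logDer_congr e, logDer_comp (hpd z hz) ((hGd z hz).clm_comp (hLd z hz))
      (isInvertible_precompDual (hi z hz)).1 ((hGi z hz).comp (hi z hz)),
      logDer_comp (hGd z hz) (hLd z hz) (hGi z hz) (hi z hz),
      logDer_precompDual (hLd z hz) (hi z hz),
      logDer_comp_map (hG.differentiableAt (hm hz)) (hψ1 z hz), two_smul]
    abel
  have hld : DifferentiableAt ℝ (logDer L) y :=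
    (contDiffAt_logDer (hLc.contDiffAt (hH.mem_nhds hy)) (hi y hy)).differentiableAt (by simp)
  have hlG : DifferentiableAt ℝ (logDer G) (ψ y) :=
    (contDiffAt_logDer (hG.contDiffAt (hm hy)) (hGi y hy)).differentiableAt (by simp)
  -- The non-tensorial error: the second derivative of ψ fed into d log |det G|, plus the Hessian of
  -- 2 log |det L|.
  set b : E →L[ℝ] E →L[ℝ] ℝ :=
    (ContinuousLinearMap.compL ℝ E E ℝ (logDer G (ψ y))) ∘L fderiv ℝ L y +
      (2 : ℝ) • fderiv ℝ (logDer L) y with hb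
  have h2 : fderiv ℝ (logDer H) y =
      precompDual (L y) ∘L (fderiv ℝ (logDer G) (ψ y) ∘L L y) + b := by
    have e : logDer H =ᶠ[nhds y] fun z => logDer G (ψ z) ∘L L z + (2 : ℝ) • logDer L z := by
      filter_upwards [hH.mem_nhds hy] with x hx using h1 x hx
    have e1 : HasFDerivAt (fun z => logDer G (ψ z)) _ y :=
      hlG.hasFDerivAt.comp y (hψ1 y hy).hasFDerivAt
    have e2 : HasFDerivAt (fun z => logDer G (ψ z) ∘L L z + (2 : ℝ) • logDer L z) _ y :=
      (e1.clm_comp (hLd y hy).hasFDerivAt).add (hld.hasFDerivAt.const_smul (2 : ℝ))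
    rw [e.fderiv_eq, e2.fderiv]
    ext v w
    simp only [hb, add_apply, comp_apply, smul_apply, flip_apply, compL_apply, precompDual_apply]
    ring
  have hanti := fun v w => fderiv_logDer_anti hH.isOpen hLc hi hJ hy hs v w
  have hbJ : b ∘L cJ E = precompDual (cJ E) ∘L b := by
    ext v w
    have e1 := (hanti v w).1
    have e2 : fderiv ℝ L y v (cJ E w) = cJ E (fderiv ℝ L y v w) := by
      rw [hs y hy, (hanti w v).1, hs y hy]
    have e3 := (hanti v (cJ E w)).2
    rw [cJ_cJ, map_neg, neg_inj] at e3
    simp only [hb, add_apply, comp_apply, smul_apply, compL_apply, precompDual_apply, e1, e2, e3]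
  -- Q = H⁻¹b anticommutes with J, so JQJ = Q, whereas cyclicity gives tr(JQJ) = -tr Q.
  have h3 : traceL E ((H y).inverse ∘L b) = 0 := by
    have e1 : ((H y).inverse ∘L b) ∘L cJ E = -(cJ E ∘L ((H y).inverse ∘L b)) := by
      rw [comp_assoc, hbJ]
      ext v
      exact hH.inverse_comp_cJ hy (b v)
    have e2 : traceL E (((H y).inverse ∘L b) ∘L cJ E) = 0 := by
      have := congrArg (traceL E) e1
      rw [map_neg, traceL_comp_comm _ (cJ E)] at this
      linarith
    have e3 : (cJ E ∘L ((H y).inverse ∘L b)) ∘L cJ E = (H y).inverse ∘L b := by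
      rw [comp_assoc, e1]
      ext v
      simp only [comp_apply, neg_apply, map_neg, cJ_cJ, neg_neg]
    have e4 := congrArg (traceL E) e3
    rw [traceL_comp_comm] at e4
    have e5 : cJ E ∘L (cJ E ∘L ((H y).inverse ∘L b)) = -((H y).inverse ∘L b) := by
      ext v
      simp only [comp_apply, neg_apply, cJ_cJ]
    rw [e5, map_neg] at e4
    linarith
  -- In the tensorial term the transposes cancel, leaving a conjugate by L of the endomorphism for
  -- G.
  have h4 : (H y).inverse ∘L (precompDual (L y) ∘L (fderiv ℝ (logDer G) (ψ y) ∘L L y)) =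
      (L y).inverse ∘L (((G (ψ y)).inverse ∘L fderiv ℝ (logDer G) (ψ y)) ∘L L y) := by
    ext v
    rw [hH.ext_iff_apply hy]
    intro w
    simp only [comp_apply]
    rw [hH.sharp_apply hy, hH' y hy]
    simp [hi y hy, hGi y hy]
  rw [chartScal, chartScal, h2, comp_add, map_add, h3, h4, traceL_comp_comm, comp_assoc, add_zero]
  congr 3
  ext v
  simp [hi y hy]

end Pullback

/-! ### Families of metrics -/

omit [FiniteDimensional ℂ E] in
lemma fderiv_partial {F : Type*} [NormedAddCommGroup F] [NormedSpace ℝ F] {f : ℝ × E → F}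
    {p : ℝ × E} (hf : DifferentiableAt ℝ f p) :
    fderiv ℝ (fun z => f (p.1, z)) p.2 = fderiv ℝ f p ∘L ContinuousLinearMap.inr ℝ ℝ E :=
  (hf.hasFDerivAt.comp p.2 (hasFDerivAt_prodMk_right p.1 p.2)).fderiv

lemma contDiffOn_chartScal {G : ℝ × E → E →L[ℝ] E →L[ℝ] ℝ} {W : Set (ℝ × E)} (hW : IsOpen W)
    (hG : ContDiffOn ℝ ∞ G W) (hi : ∀ p ∈ W, (G p).IsInvertible) :
    ContDiffOn ℝ ∞ (fun p : ℝ × E => chartScal (fun z => G (p.1, z)) p.2) W := by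
  have hGd : ∀ p ∈ W, ContDiffAt ℝ ∞ G p := fun p hp => hG.contDiffAt (hW.mem_nhds hp)
  have hGi : ContDiffOn ℝ ∞ (fun p => (G p).inverse) W := fun p hp =>
    (contDiffAt_inverse (hGd p hp) (hi p hp)).contDiffWithinAt
  have hD : ContDiffOn ℝ ∞ (fun p => fderiv ℝ G p ∘L ContinuousLinearMap.inr ℝ ℝ E) W :=
    (hG.fderiv_of_isOpen hW (by simp)).clm_comp contDiffOn_const
  set a : ℝ × E → E →L[ℝ] ℝ := fun p => logDer (fun z => G (p.1, z)) p.2 with ha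
  have h1 : ContDiffOn ℝ ∞ a W := by
    refine ContDiffOn.congr (f := fun p => traceL E ∘L
      (ContinuousLinearMap.compL ℝ E (E →L[ℝ] ℝ) E (G p).inverse) ∘L
        (fderiv ℝ G p ∘L ContinuousLinearMap.inr ℝ ℝ E)) ?_ fun p hp => ?_
    · exact contDiffOn_const.clm_comp
        (((ContinuousLinearMap.contDiff _).comp_contDiffOn hGi).clm_comp hD)
    · simp only [ha, logDer]
      rw [fderiv_partial ((hGd p hp).differentiableAt (by simp))]
  refine ContDiffOn.congr (f := fun p => -(2⁻¹ * traceL E ((G p).inverse ∘L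
      (fderiv ℝ a p ∘L ContinuousLinearMap.inr ℝ ℝ E)))) ?_ fun p hp => ?_
  · exact (contDiffOn_const.mul ((traceL E).contDiff.comp_contDiffOn
      (hGi.clm_comp ((h1.fderiv_of_isOpen hW (by simp)).clm_comp contDiffOn_const)))).neg
  · have := fderiv_partial ((h1.contDiffAt (hW.mem_nhds hp)).differentiableAt (by simp))
    rw [chartScal, ← this]

/-- The factor t makes continuity of Q at 0 sufficient, so the term t DR_t below need not have its
second factor differentiated in t. -/
lemma hasDerivAt_smul_self {F : Type*} [NormedAddCommGroup F] [NormedSpace ℝ F] {Q : ℝ → F}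
    (hQ : ContinuousAt Q 0) : HasDerivAt (fun t => t • Q t) (Q 0) 0 := by
  rw [hasDerivAt_iff_tendsto_slope_zero]
  refine (hQ.tendsto.mono_left nhdsWithin_le_nhds).congr' ?_
  filter_upwards [self_mem_nhdsWithin] with t ht
  simp [smul_smul, inv_mul_cancel₀ (show t ≠ 0 from ht)]

/-- With P_t = Id + tA and R_t = tr(P_t⁻¹ dA), multiplicativity gives the exact formula -½ tr(P_t⁻¹
G⁻¹(D²log |det G| + t DR_t)) near t = 0. Its derivative uses only that P_t⁻¹ has derivative -A at 0
and that R_0 = d tr A. -/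
lemma hasDerivAt_chartScal {G : E → E →L[ℝ] E →L[ℝ] ℝ} {U : Set E} (hG : IsHermitianOn G U)
    {A : E → E →L[ℝ] E} (hA : ContDiffOn ℝ ∞ A U) {y : E} (hy : y ∈ U) :
    HasDerivAt (fun t : ℝ => chartScal (fun z => G z ∘L (ContinuousLinearMap.id ℝ E + t • A z)) y)
      (2⁻¹ * traceL E ((G y).inverse ∘L fderiv ℝ (logDer G) y ∘L A y) -
        2⁻¹ * traceL E ((G y).inverse ∘L fderiv ℝ (fderiv ℝ (fun z => traceL E (A z))) y)) 0 := by
  set P : ℝ × E → E →L[ℝ] E := fun p => ContinuousLinearMap.id ℝ E + p.1 • A p.2 with hP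
  set R : ℝ × E → E →L[ℝ] ℝ := fun p => traceL E ∘L
    (ContinuousLinearMap.compL ℝ E E E (P p).inverse) ∘L fderiv ℝ A p.2 with hR
  set Q : ℝ → E →L[ℝ] E →L[ℝ] ℝ := fun t => fderiv ℝ (fun z => R (t, z)) y with hQ
  have hO : IsOpen (Set.univ ×ˢ U : Set (ℝ × E)) := isOpen_univ.prod hG.isOpen
  have hAd : ∀ z ∈ U, DifferentiableAt ℝ A z := fun z hz =>
    (hA.contDiffAt (hG.mem_nhds hz)).differentiableAt (by simp)
  have hA2 : ContDiffOn ℝ ∞ (fun p : ℝ × E => A p.2) (Set.univ ×ˢ U) :=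
    hA.comp contDiffOn_snd fun p hp => hp.2
  have hDA2 : ContDiffOn ℝ ∞ (fun p : ℝ × E => fderiv ℝ A p.2) (Set.univ ×ˢ U) :=
    (hA.fderiv_of_isOpen hG.isOpen (by simp)).comp contDiffOn_snd fun p hp => hp.2
  have hPc : ContDiffOn ℝ ∞ P (Set.univ ×ˢ U) := contDiffOn_const.add (contDiffOn_fst.smul hA2)
  have hP0 : ∀ z, P (0, z) = ContinuousLinearMap.id ℝ E := fun z => by simp [hP]
  have hPi0 : (P (0, y)).IsInvertible := by
    rw [hP0]; exact ⟨ContinuousLinearEquiv.refl ℝ E, rfl⟩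
  have hPy : ContDiffAt ℝ ∞ P (0, y) := hPc.contDiffAt (hO.mem_nhds ⟨trivial, hy⟩)
  have hRy : ContDiffAt ℝ ∞ R (0, y) :=
    contDiffAt_const.clm_comp (((ContinuousLinearMap.contDiff _).contDiffAt.comp _
      (contDiffAt_inverse hPy hPi0)).clm_comp (hDA2.contDiffAt (hO.mem_nhds ⟨trivial, hy⟩)))
  have hcont : Continuous fun t : ℝ => (t, y) := by fun_prop
  have hRev : ∀ᶠ t in nhds (0 : ℝ), DifferentiableAt ℝ R (t, y) := by
    -- The order is lowered to a finite one, since only then does regularity at a point spread to a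
    -- neighbourhood.
    have h1 : ContDiffAt ℝ 1 R (0, y) := hRy.of_le (by simp)
    have h2 := h1.eventually (by simp)
    filter_upwards [hcont.continuousAt.eventually h2] with t ht
    exact ht.differentiableAt one_ne_zero
  have hQev : ∀ᶠ t in nhds (0 : ℝ), Q t = fderiv ℝ R (t, y) ∘L ContinuousLinearMap.inr ℝ ℝ E := by
    filter_upwards [hRev] with t ht using fderiv_partial ht
  have hQc : ContinuousAt Q 0 := by
    have h1 : ContDiffAt ℝ 0 (fderiv ℝ R) (0, y) := hRy.fderiv_right (by simp)
    have h2 : ContinuousAt (fun t : ℝ => fderiv ℝ R (t, y)) 0 :=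
      ContinuousAt.comp (f := fun t : ℝ => (t, y)) h1.continuousAt hcont.continuousAt
    exact (h2.clm_comp continuousAt_const).congr (Filter.EventuallyEq.symm hQev)
  have hQ0 : Q 0 = fderiv ℝ (fderiv ℝ (fun z => traceL E (A z))) y := by
    refine Filter.EventuallyEq.fderiv_eq ?_
    filter_upwards [hG.mem_nhds hy] with z hz
    have : HasFDerivAt (fun z => traceL E (A z)) _ z :=
      (traceL E).hasFDerivAt.comp z (hAd z hz).hasFDerivAt
    rw [this.fderiv]
    ext v
    simp only [hR, comp_apply, hP0, compL_apply, inverse_id, id_comp]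
  have hPev : ∀ᶠ t in nhds (0 : ℝ), (P (t, y)).IsInvertible :=
    eventually_isInvertible (M := fun t : ℝ => P (t, y))
      (ContinuousAt.comp (f := fun t : ℝ => (t, y)) hPy.continuousAt hcont.continuousAt) hPi0
  have hmain : (fun t : ℝ => chartScal (fun z => G z ∘L P (t, z)) y) =ᶠ[nhds 0] fun t =>
      -(2⁻¹ * traceL E ((P (t, y)).inverse ∘L
        ((G y).inverse ∘L (fderiv ℝ (logDer G) y + t • Q t)))) := by
    filter_upwards [hPev, hRev] with t ht hRt
    have hPd : ∀ z ∈ U, HasFDerivAt (fun z => P (t, z)) (t • fderiv ℝ A z) z := fun z hz =>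
      ((hAd z hz).hasFDerivAt.const_smul t).const_add _
    have hPinv := eventually_isInvertible (M := fun z => P (t, z))
      (hPd y hy).continuousAt ht
    have h1 : logDer (fun z => G z ∘L P (t, z)) =ᶠ[nhds y]
        fun z => logDer G z + t • R (t, z) := by
      filter_upwards [hPinv, hG.mem_nhds hy] with z hz hzU
      rw [logDer_comp (hG.differentiableAt hzU) (hPd z hzU).differentiableAt
        (hG.isInvertible z hzU) hz]
      congr 1
      ext v
      rw [logDer_apply, (hPd z hzU).fderiv]
      simp [hR]
    have hlG : DifferentiableAt ℝ (logDer G) y :=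
      (contDiffAt_logDer (hG.contDiffAt hy) (hG.isInvertible y hy)).differentiableAt (by simp)
    have hRt' : DifferentiableAt ℝ (fun z => R (t, z)) y :=
      hRt.comp y (hasFDerivAt_prodMk_right t y).differentiableAt
    have h2 : (G y ∘L P (t, y)).inverse = (P (t, y)).inverse ∘L (G y).inverse :=
      (hG.isInvertible y hy).inverse_comp_of_left
    have h3 : HasFDerivAt (fun z => logDer G z + t • R (t, z)) _ y :=
      hlG.hasFDerivAt.add (hRt'.hasFDerivAt.const_smul t)
    rw [chartScal, h1.fderiv_eq, h3.fderiv, h2, comp_assoc]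
  have hPder : HasDerivAt (fun t : ℝ => (P (t, y)).inverse) (-A y) 0 := by
    have h1 : HasDerivAt (fun t : ℝ => P (t, y)) (A y) 0 := by
      simpa [hP] using! ((hasDerivAt_id (0 : ℝ)).smul_const (A y)).const_add
        (ContinuousLinearMap.id ℝ E)
    have h2 : ContDiffAt ℝ 1 (fun t : ℝ => P (t, y)) 0 :=
      contDiffAt_const.add (contDiffAt_id.smul (contDiffAt_const (c := A y)))
    have h3 := fderiv_inverse_apply h2 hPi0 1
    have h4 := ((contDiffAt_inverse h2 hPi0).differentiableAt one_ne_zero).hasDerivAt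
    rw [fderiv_apply_one_eq_deriv, fderiv_apply_one_eq_deriv, h1.deriv, hP0] at h3
    rw [h3] at h4
    simpa using h4
  have hder := hPder.clm_comp ((hasDerivAt_const (0 : ℝ) (G y).inverse).clm_comp
    ((hasDerivAt_smul_self hQc).const_add (fderiv ℝ (logDer G) y)))
  have hder2 := (((traceL E).hasFDerivAt.comp_hasDerivAt (0 : ℝ) hder).const_mul 2⁻¹).neg
  refine HasDerivAt.congr_of_eventuallyEq ?_ hmain
  refine hder2.congr_deriv ?_
  simp only [hP0, hQ0, inverse_id, zero_smul, add_zero, id_comp, zero_comp, zero_add, map_add,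
    neg_comp, map_neg]
  rw [traceL_comp_comm _ (A y), comp_assoc]
  ring

end ChartScal

section CoordinateChange

variable {E : Type*} [NormedAddCommGroup E] [NormedSpace ℂ E] {M : Type*} [TopologicalSpace M]
  [ChartedSpace E M] [IsManifold 𝓘(ℂ, E) ω M]

/-! ### Coordinate changes -/

lemma hasFDerivAt_coordChange {x y z : M} (hx : z ∈ (chartAt E x).source)
    (hy : z ∈ (chartAt E y).source) :
    HasFDerivAt (chartAt E y ∘ (chartAt E x).symm) (tangentCoordChange 𝓘(ℝ, E) x y z)
      (chartAt E x z) := by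
  have h := hasFDerivWithinAt_tangentCoordChange (I := 𝓘(ℝ, E)) (x := x) (y := y) (z := z)
    (by simp [hx, hy])
  simpa [hasFDerivWithinAt_univ] using! h

/-- The real and complex coordinate changes are derivatives of the same map, so the real one is
complex linear. -/
lemma tangentCoordChange_cJ {x y z : M} (hx : z ∈ (chartAt E x).source)
    (hy : z ∈ (chartAt E y).source) (v : E) :
    tangentCoordChange 𝓘(ℝ, E) x y z (cJ E v) = cJ E (tangentCoordChange 𝓘(ℝ, E) x y z v) := by
  have h := hasFDerivWithinAt_tangentCoordChange (I := 𝓘(ℂ, E)) (x := x) (y := y) (z := z)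
    (by simp [hx, hy])
  have h1 : HasFDerivAt (chartAt E y ∘ (chartAt E x).symm) (tangentCoordChange 𝓘(ℂ, E) x y z)
      (chartAt E x z) := by
    simpa [hasFDerivWithinAt_univ] using! h
  rw [(hasFDerivAt_coordChange hx hy).unique (h1.restrictScalars ℝ)]
  simp

lemma tangentCoordChange_comp_self {x y z : M} (hx : z ∈ (chartAt E x).source)
    (hy : z ∈ (chartAt E y).source) :
    tangentCoordChange 𝓘(ℝ, E) y x z ∘L tangentCoordChange 𝓘(ℝ, E) x y z =
      ContinuousLinearMap.id ℝ E := by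
  ext v
  rw [comp_apply, tangentCoordChange_comp (by simp [hx, hy]), tangentCoordChange_self (by simp [hx])]
  rfl

lemma isInvertible_tangentCoordChange {x y z : M} (hx : z ∈ (chartAt E x).source)
    (hy : z ∈ (chartAt E y).source) : (tangentCoordChange 𝓘(ℝ, E) x y z).IsInvertible :=
  .of_inverse (tangentCoordChange_comp_self hy hx) (tangentCoordChange_comp_self hx hy)

lemma mfderiv_chartAt_symm {x z : M} (hz : z ∈ (chartAt E x).source) :
    (mfderiv 𝓘(ℝ, E) 𝓘(ℝ, E) (chartAt E x).symm (chartAt E x z) : E →L[ℝ] E) =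
      tangentCoordChange 𝓘(ℝ, E) x z z := by
  have h1 := TangentBundle.symmL_trivializationAt (I := 𝓘(ℝ, E)) hz
  have h2 := TangentBundle.symmL_trivializationAt_eq_core (I := 𝓘(ℝ, E)) hz
  rw [h2] at h1
  simpa [mfderivWithin_univ] using! h1.symm

/-- A bilinear form on `T_z M`, in the coordinates of the preferred chart at `x`. -/
def bilinCoord (B : M → E →L[ℝ] E →L[ℝ] ℝ) (x z : M) : E →L[ℝ] E →L[ℝ] ℝ :=
  (B z).bilinearComp (tangentCoordChange 𝓘(ℝ, E) x z z) (tangentCoordChange 𝓘(ℝ, E) x z z)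

/-- An endomorphism of `T_z M`, in the coordinates of the preferred chart at `x`. -/
def endCoord (A : M → E →L[ℝ] E) (x z : M) : E →L[ℝ] E :=
  tangentCoordChange 𝓘(ℝ, E) z x z ∘L A z ∘L tangentCoordChange 𝓘(ℝ, E) x z z

/-- The endomorphism `h` of `T_z M`, as an endomorphism of `E`. -/
def endAt (h : SmoothEnd E M) (z : M) : E →L[ℝ] E := h z

/-- Read in the hom-bundle trivialization at x, a bilinear form is precisely `bilinCoord B x`; this
passes between smooth sections and smooth components. -/
lemma contMDiff_bilin_iff
    (B : ∀ z : M, TangentSpace 𝓘(ℝ, E) z →L[ℝ] TangentSpace 𝓘(ℝ, E) z →L[ℝ] ℝ) :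
    ContMDiff 𝓘(ℝ, E) (𝓘(ℝ, E).prod 𝓘(ℝ, E →L[ℝ] E →L[ℝ] ℝ)) ∞
      (fun z ↦ TotalSpace.mk' (E →L[ℝ] E →L[ℝ] ℝ) z (B z)) ↔
    ∀ x, ContMDiffOn 𝓘(ℝ, E) 𝓘(ℝ, E →L[ℝ] E →L[ℝ] ℝ) ∞ (bilinCoord B x) (chartAt E x).source := by
  have key : ∀ x, ContMDiffOn 𝓘(ℝ, E) (𝓘(ℝ, E).prod 𝓘(ℝ, E →L[ℝ] E →L[ℝ] ℝ)) ∞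
      (fun z ↦ TotalSpace.mk' (E →L[ℝ] E →L[ℝ] ℝ) z (B z)) (chartAt E x).source ↔
      ContMDiffOn 𝓘(ℝ, E) 𝓘(ℝ, E →L[ℝ] E →L[ℝ] ℝ) ∞ (bilinCoord B x) (chartAt E x).source := by
    intro x
    rw [(trivializationAt (E →L[ℝ] E →L[ℝ] ℝ) (fun z : M => TangentSpace 𝓘(ℝ, E) z →L[ℝ]
      TangentSpace 𝓘(ℝ, E) z →L[ℝ] ℝ) x).contMDiffOn_section_iff (chartAt E x).open_source
      (by simp [hom_trivializationAt_baseSet])]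
    refine contMDiffOn_congr fun z hz => ?_
    rw [hom_trivializationAt_apply]
    ext v w
    have h := TangentBundle.symmL_trivializationAt_eq_core (I := 𝓘(ℝ, E)) hz
    have h' : ∀ v, (trivializationAt E (TangentSpace 𝓘(ℝ, E)) x).symm z v =
        tangentCoordChange 𝓘(ℝ, E) x z z v := fun v => by
      rw [← Trivialization.symmL_apply (R := ℝ) _ (by simpa using hz), h]
      rfl
    change inCoordinates E (TangentSpace 𝓘(ℝ, E)) (E →L[ℝ] ℝ) (fun z : M =>
      TangentSpace 𝓘(ℝ, E) z →L[ℝ] ℝ) x z x z (B z) v w = _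
    erw [inCoordinates_apply_eq₂ (by simpa using hz) (by simpa using hz) (by simp), h', h']
    simp only [Bundle.Trivial.fiberBundle_trivializationAt', Bundle.Trivial.linearMapAt_trivialization]
    rfl
  refine ⟨fun h x => (key x).1 h.contMDiffOn, fun h x => ?_⟩
  exact ((key x).2 (h x)).contMDiffAt ((chartAt E x).open_source.mem_nhds (mem_chart_source E x))

lemma contMDiffOn_endCoord (h : SmoothEnd E M) (x : M) :
    ContMDiffOn 𝓘(ℝ, E) 𝓘(ℝ, E →L[ℝ] E) ∞ (endCoord (endAt h) x) (chartAt E x).source := by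
  have h1 := (h.contMDiff).contMDiffOn (s := (chartAt E x).source)
  rw [(trivializationAt (E →L[ℝ] E) (fun z : M => TangentSpace 𝓘(ℝ, E) z →L[ℝ]
      TangentSpace 𝓘(ℝ, E) z) x).contMDiffOn_section_iff (chartAt E x).open_source
      (by simp [hom_trivializationAt_baseSet])] at h1
  refine h1.congr fun z hz => ?_
  rw [hom_trivializationAt_apply]
  ext v
  have e1 := TangentBundle.symmL_trivializationAt_eq_core (I := 𝓘(ℝ, E)) hz
  have e2 := TangentBundle.continuousLinearMapAt_trivializationAt_eq_core (I := 𝓘(ℝ, E)) hz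
  change _ = ((trivializationAt E (TangentSpace 𝓘(ℝ, E)) x).continuousLinearMapAt ℝ z ∘L
    (h z ∘L (trivializationAt E (TangentSpace 𝓘(ℝ, E)) x).symmL ℝ z)) v
  rw [e1, e2]
  rfl

lemma contDiffOn_of_contMDiffOn {F : Type*} [NormedAddCommGroup F] [NormedSpace ℝ F] {x : M}
    {f : M → F} (hf : ContMDiffOn 𝓘(ℝ, E) 𝓘(ℝ, F) ∞ f (chartAt E x).source) :
    ContDiffOn ℝ ∞ (fun y => f ((chartAt E x).symm y)) (chartAt E x).target := by
  rw [← contMDiffOn_iff_contDiffOn]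
  exact hf.comp (contMDiffOn_chart_symm (I := 𝓘(ℝ, E))) (chartAt E x).mapsTo_symm

end CoordinateChange

/-! ### Metrics in charts -/

section MetricChart

variable {E : Type*} [NormedAddCommGroup E] [NormedSpace ℂ E] {M : Type*} [TopologicalSpace M]
  [ChartedSpace E M] [IsManifold 𝓘(ℂ, E) ω M]

lemma inChart_eq (g : HermitianMetric E M) (x : M) {y : E} (hy : y ∈ (chartAt E x).target) :
    inChart g x y = bilinCoord (metricAt g) x ((chartAt E x).symm y) := by
  have h := mfderiv_chartAt_symm ((chartAt E x).map_target hy)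
  rw [(chartAt E x).right_inv hy] at h
  rw [inChart, h, bilinCoord]

lemma inChart_self (g : HermitianMetric E M) (x : M) :
    inChart g x (chartAt E x x) = metricAt g x := by
  have h : tangentCoordChange 𝓘(ℝ, E) x x x = ContinuousLinearMap.id ℝ E := by
    ext v
    exact tangentCoordChange_self (by simp)
  rw [inChart_eq g x (mem_chart_target E x), (chartAt E x).left_inv (mem_chart_source E x),
    bilinCoord, h]
  rfl

lemma contMDiffOn_bilinCoord (g : HermitianMetric E M) (x : M) :
    ContMDiffOn 𝓘(ℝ, E) 𝓘(ℝ, E →L[ℝ] E →L[ℝ] ℝ) ∞ (bilinCoord (metricAt g) x)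
      (chartAt E x).source :=
  (contMDiff_bilin_iff _).1 g.contMDiff x

variable [FiniteDimensional ℂ E]

lemma isInvertible_of_pos {B : E →L[ℝ] E →L[ℝ] ℝ} (hB : ∀ v, v ≠ 0 → 0 < B v v) :
    B.IsInvertible := by
  have hinj : Function.Injective (B : E →ₗ[ℝ] E →L[ℝ] ℝ) := by
    rw [← LinearMap.ker_eq_bot, LinearMap.ker_eq_bot']
    intro v hv
    by_contra hne
    have h1 := hB v hne
    have h2 : B v = 0 := hv
    simp [h2] at h1
  have hdim : Module.finrank ℝ E = Module.finrank ℝ (E →L[ℝ] ℝ) := by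
    rw [← (LinearMap.toContinuousLinearMap : (E →ₗ[ℝ] ℝ) ≃ₗ[ℝ] (E →L[ℝ] ℝ)).finrank_eq]
    exact (Subspace.dual_finrank_eq (K := ℝ) (V := E)).symm
  refine ⟨(LinearEquiv.ofInjectiveOfFinrankEq (B : E →ₗ[ℝ] E →L[ℝ] ℝ) hinj
    hdim).toContinuousLinearEquiv, ?_⟩
  ext v w
  rfl

omit [FiniteDimensional ℂ E] in
lemma bilinCoord_pos (g : HermitianMetric E M) {x z : M} (hz : z ∈ (chartAt E x).source) {v : E}
    (hv : v ≠ 0) : 0 < bilinCoord (metricAt g) x z v v := by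
  refine g.pos z _ fun h0 => hv ?_
  exact (isInvertible_tangentCoordChange hz (mem_chart_source E z)).bijective.injective
    (h0.trans (map_zero _).symm)

lemma isHermitianOn_inChart (g : HermitianMetric E M) (x : M) :
    IsHermitianOn (inChart g x) (chartAt E x).target where
  isOpen := (chartAt E x).open_target
  contDiffOn := (contDiffOn_of_contMDiffOn (contMDiffOn_bilinCoord g x)).congr
    fun y hy => inChart_eq g x hy
  symm y hy v w := by
    rw [inChart_eq g x hy]
    exact g.symm _ _ _
  herm y hy v w := by
    rw [inChart_eq g x hy]
    have hz := (chartAt E x).map_target hy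
    simp only [bilinCoord, bilinearComp_apply]
    rw [tangentCoordChange_cJ hz (mem_chart_source E _),
      tangentCoordChange_cJ hz (mem_chart_source E _)]
    exact g.hermitian _ _ _
  isInvertible y hy := by
    rw [inChart_eq g x hy]
    exact isInvertible_of_pos fun v hv => bilinCoord_pos g ((chartAt E x).map_target hy) hv

/-- `scalCh g z` is defined in the preferred chart at z, which need not vary continuously with z.
Applying `chartScal_pullback` to the transition map replaces it by a fixed chart around x. -/
lemma scalCh_eq (g : HermitianMetric E M) {x z : M} (hz : z ∈ (chartAt E x).source) :
    scalCh g z = chartScal (inChart g x) (chartAt E x z) := by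
  have hzz := mem_chart_source E z
  rw [scalCh, ← inChart_self,
    (isHermitianOn_inChart g z).two_mul_TrC_chernRicciForm (mem_chart_target E z)]
  set T := (chartAt E z).symm.trans (chartAt E x) with hTdef
  have hsub : ∀ y ∈ T.source, y ∈ (chartAt E z).target ∧ (chartAt E z).symm y ∈
      (chartAt E x).source := fun y hy => by simpa [hTdef] using hy
  have hd : ∀ y ∈ T.source, HasFDerivAt (chartAt E x ∘ (chartAt E z).symm)
      (tangentCoordChange 𝓘(ℝ, E) z x ((chartAt E z).symm y)) y := fun y hy => by
    have h := hasFDerivAt_coordChange ((chartAt E z).map_target (hsub y hy).1) (hsub y hy).2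
    rwa [(chartAt E z).right_inv (hsub y hy).1] at h
  have hmem : chartAt E z z ∈ T.source := by simp [hTdef, hz]
  have hH := (isHermitianOn_inChart g z).mono T.open_source fun y hy => (hsub y hy).1
  have h := chartScal_pullback (isHermitianOn_inChart g x) hH
    (ψ := chartAt E x ∘ (chartAt E z).symm) ?_ ?_ ?_ ?_ ?_ hmem
  · rw [h]; simp
  · have h1 : ContMDiffOn 𝓘(ℝ, E) 𝓘(ℝ, E) ∞ (chartAt E x ∘ (chartAt E z).symm) T.source :=
      (contMDiffOn_chart (I := 𝓘(ℝ, E)) (n := ∞) (x := x)).comp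
        ((contMDiffOn_chart_symm (I := 𝓘(ℝ, E)) (n := ∞) (x := z)).mono
          fun y hy => (hsub y hy).1) fun y hy => (hsub y hy).2
    exact h1.contDiffOn
  · intro y hy
    exact (chartAt E x).map_source (hsub y hy).2
  · intro y hy
    rw [(hd y hy).fderiv]
    exact isInvertible_tangentCoordChange ((chartAt E z).map_target (hsub y hy).1) (hsub y hy).2
  · intro y hy v
    rw [(hd y hy).fderiv]
    exact tangentCoordChange_cJ ((chartAt E z).map_target (hsub y hy).1) (hsub y hy).2 v
  · intro y hy
    obtain ⟨hy1, hy2⟩ := hsub y hy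
    rw [(hd y hy).fderiv, inChart_eq g z hy1]
    simp only [Function.comp_apply]
    rw [inChart_eq g x ((chartAt E x).map_source hy2), (chartAt E x).left_inv hy2]
    ext v w
    have h3 := (chartAt E z).map_target hy1
    simp only [bilinCoord, bilinearComp_apply]
    rw [tangentCoordChange_comp (by simp [hy2, h3]), tangentCoordChange_comp (by simp [hy2, h3])]

end MetricChart

section Deformation

variable {E : Type*} [NormedAddCommGroup E] [NormedSpace ℂ E] {M : Type*} [TopologicalSpace M]
  [ChartedSpace E M] [IsManifold 𝓘(ℂ, E) ω M]

/-! ### The deformation `g((Id + th)·, ·)` -/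

lemma exists_coercive [FiniteDimensional ℂ E] {B : E →L[ℝ] E →L[ℝ] ℝ}
    (hB : ∀ v, v ≠ 0 → 0 < B v v) : ∃ c : ℝ, 0 < c ∧ ∀ v, c * ‖v‖ ^ 2 ≤ B v v := by
  have : FiniteDimensional ℝ E := FiniteDimensional.complexToReal E
  have : ProperSpace E := FiniteDimensional.proper ℝ E
  rcases subsingleton_or_nontrivial E with hE | hE
  · exact ⟨1, one_pos, fun v => by simp [Subsingleton.elim v 0]⟩
  obtain ⟨v0, hv0, hmin⟩ := (isCompact_sphere (0 : E) 1).exists_isMinOn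
    (NormedSpace.sphere_nonempty.2 zero_le_one) (f := fun v => B v v) (by fun_prop)
  have hv0' : v0 ≠ 0 := by
    rintro rfl
    simp at hv0
  refine ⟨B v0 v0, hB v0 hv0', fun v => ?_⟩
  rcases eq_or_ne v 0 with rfl | hv
  · simp
  have hn : ‖v‖ ≠ 0 := norm_ne_zero_iff.2 hv
  have h1 : (‖v‖⁻¹ • v) ∈ Metric.sphere (0 : E) 1 := by
    simp [norm_smul, hn]
  have h2 : B v0 v0 ≤ B (‖v‖⁻¹ • v) (‖v‖⁻¹ • v) := hmin h1
  simp only [map_smul, smul_apply, smul_eq_mul] at h2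
  calc B v0 v0 * ‖v‖ ^ 2 ≤ (‖v‖⁻¹ * (‖v‖⁻¹ * B v v)) * ‖v‖ ^ 2 := by gcongr
    _ = B v v := by field_simp

lemma tangentCoordChange_endCoord (A : M → E →L[ℝ] E) {x z : M} (hz : z ∈ (chartAt E x).source)
    (v : E) : tangentCoordChange 𝓘(ℝ, E) x z z (endCoord A x z v) =
      A z (tangentCoordChange 𝓘(ℝ, E) x z z v) :=
  DFunLike.congr_fun (tangentCoordChange_comp_self (mem_chart_source E z) hz) _

lemma exists_local_bound [FiniteDimensional ℂ E] (g : HermitianMetric E M) (h : SmoothEnd E M)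
    (x : M) : ∃ C : ℝ, ∀ᶠ z in nhds x, ∀ v : E,
      |metricAt g z (endAt h z v) v| ≤ C * metricAt g z v v := by
  have hx := mem_chart_source E x
  have hnx := (chartAt E x).open_source.mem_nhds hx
  have hB : ContinuousAt (bilinCoord (metricAt g) x) x :=
    (contMDiffOn_bilinCoord g x).continuousOn.continuousAt hnx
  have hA : ContinuousAt (endCoord (endAt h) x) x :=
    (contMDiffOn_endCoord h x).continuousOn.continuousAt hnx
  obtain ⟨c, hc, hcB⟩ := exists_coercive fun v (hv : v ≠ 0) => bilinCoord_pos g hx hv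
  set K := ‖bilinCoord (metricAt g) x x‖ + 1
  set K' := ‖endCoord (endAt h) x x‖ + 1
  have h1 : ∀ᶠ z in nhds x, ‖bilinCoord (metricAt g) x z - bilinCoord (metricAt g) x x‖ < c / 2 := by
    have := hB.eventually (Metric.ball_mem_nhds _ (half_pos hc))
    filter_upwards [this] with z hz
    simpa [dist_eq_norm] using hz
  have h2 : ∀ᶠ z in nhds x, ‖bilinCoord (metricAt g) x z‖ < K :=
    hB.norm.eventually (gt_mem_nhds (lt_add_one _))
  have h3 : ∀ᶠ z in nhds x, ‖endCoord (endAt h) x z‖ < K' :=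
    hA.norm.eventually (gt_mem_nhds (lt_add_one _))
  refine ⟨K * K' * (2 / c), ?_⟩
  filter_upwards [h1, h2, h3, hnx] with z h1 h2 h3 hz v
  have key : ∀ w : E, |bilinCoord (metricAt g) x z (endCoord (endAt h) x z w) w| ≤
      K * K' * (2 / c) * bilinCoord (metricAt g) x z w w := by
    intro w
    -- Coercivity with constant c at x, minus a perturbation of norm less than c/2.
    have e1 : c / 2 * ‖w‖ ^ 2 ≤ bilinCoord (metricAt g) x z w w := by
      have := le_opNorm₂ (bilinCoord (metricAt g) x z - bilinCoord (metricAt g) x x) w w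
      have h4 := hcB w
      have h5 := (abs_le.1 (Real.norm_eq_abs _ ▸ this)).1
      simp only [sub_apply] at h5
      nlinarith [mul_le_mul_of_nonneg_right h1.le (sq_nonneg ‖w‖)]
    have e2 : ‖w‖ ^ 2 ≤ 2 / c * bilinCoord (metricAt g) x z w w := by
      rw [div_mul_eq_mul_div, le_div_iff₀ hc]
      linarith
    have hK : 0 ≤ K := by positivity
    have hK' : 0 ≤ K' := by positivity
    calc |bilinCoord (metricAt g) x z (endCoord (endAt h) x z w) w|
        ≤ ‖bilinCoord (metricAt g) x z‖ * ‖endCoord (endAt h) x z w‖ * ‖w‖ :=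
          (Real.norm_eq_abs _).symm.trans_le (le_opNorm₂ _ _ _)
      _ ≤ K * (K' * ‖w‖) * ‖w‖ := by
          gcongr
          exact (le_opNorm _ _).trans (by gcongr)
      _ = K * K' * ‖w‖ ^ 2 := by ring
      _ ≤ K * K' * (2 / c * bilinCoord (metricAt g) x z w w) := by gcongr
      _ = _ := by ring
  obtain ⟨w, hw⟩ := (isInvertible_tangentCoordChange hz (mem_chart_source E z)).bijective.surjective v
  have := key w
  simp only [bilinCoord, bilinearComp_apply] at this
  rw [tangentCoordChange_endCoord _ hz, hw] at this
  exact this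

/-- Local bounds combine over a finite cover: constants may be added or enlarged because g(v, v) ≥
0. -/
lemma exists_global_bound [FiniteDimensional ℂ E] [CompactSpace M] (g : HermitianMetric E M)
    (h : SmoothEnd E M) : ∃ C : ℝ, 0 < C ∧ ∀ (z : M) (v : E),
      |metricAt g z (endAt h z v) v| ≤ C * metricAt g z v v := by
  have hpos : ∀ (z : M) (v : E), 0 ≤ metricAt g z v v := fun z v => by
    rcases eq_or_ne v 0 with rfl | hv
    · simp
    · exact (g.pos z v hv).le
  have := isCompact_univ (X := M).induction_on
    (p := fun s => ∃ C : ℝ, 0 < C ∧ ∀ z ∈ s, ∀ v : E,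
      |metricAt g z (endAt h z v) v| ≤ C * metricAt g z v v)
    ⟨1, one_pos, by simp⟩ (fun s t hst ⟨C, hC, hCt⟩ => ⟨C, hC, fun z hz => hCt z (hst hz)⟩)
    (fun s t ⟨C, hC, hCs⟩ ⟨D, hD, hDt⟩ => ⟨C + D, by positivity, fun z hz v => by
      have := hpos z v
      rcases hz with hz | hz
      · exact (hCs z hz v).trans (by gcongr; linarith)
      · exact (hDt z hz v).trans (by gcongr; linarith)⟩)
    (fun x _ => by
      obtain ⟨C, hC⟩ := exists_local_bound g h x
      refine ⟨_, mem_nhdsWithin_of_mem_nhds hC, |C| + 1, by positivity, fun z hz v => ?_⟩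
      have := hpos z v
      exact (hz v).trans (by gcongr; linarith [le_abs_self C]))
  obtain ⟨C, hC, h1⟩ := this
  exact ⟨C, hC, fun z => h1 z trivial⟩

/-- The components of `g((Id + tA)·, ·)`. -/
lemma bilinCoord_comp_id_add (g : HermitianMetric E M) (A : M → E →L[ℝ] E) (t : ℝ) {x z : M}
    (hz : z ∈ (chartAt E x).source) :
    bilinCoord (fun z => metricAt g z ∘L (ContinuousLinearMap.id ℝ E + t • A z)) x z =
      bilinCoord (metricAt g) x z ∘L (ContinuousLinearMap.id ℝ E + t • endCoord A x z) := by
  ext v w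
  simp only [bilinCoord, bilinearComp_apply, comp_apply, add_apply, smul_apply, id_apply, map_add,
    map_smul, tangentCoordChange_endCoord A hz]

/-- The bound `ht` gives g_t ≥ ½g, hence positivity. Symmetry of g_t comes from symmetry of h, and
J-invariance from h commuting with J. -/
lemma exists_deformation (g : HermitianMetric E M) (h : SmoothEnd E M) (hh : IsSym11 g h) {t : ℝ}
    (ht : ∀ (z : M) (v : E), |t * metricAt g z (endAt h z v) v| ≤ 2⁻¹ * metricAt g z v v) :
    ∃ g' : HermitianMetric E M, ∀ z, metricAt g' z =
      metricAt g z ∘L (ContinuousLinearMap.id ℝ E + t • endAt h z) := by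
  have happ : ∀ (z : M) (v w : E), (metricAt g z ∘L
      (ContinuousLinearMap.id ℝ E + t • endAt h z)) v w =
      metricAt g z v w + t * metricAt g z (endAt h z v) w := fun z v w => by
    simp only [comp_apply, add_apply, smul_apply, map_add, map_smul, smul_eq_mul]
    rfl
  have hhalf : ∀ (z : M) (v : E), 2⁻¹ * metricAt g z v v ≤ (metricAt g z ∘L
      (ContinuousLinearMap.id ℝ E + t • endAt h z)) v v := fun z v => by
    rw [happ]
    linarith [(abs_le.1 (ht z v)).1]
  let B : M → E →L[ℝ] E →L[ℝ] ℝ := fun z =>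
    metricAt g z ∘L (ContinuousLinearMap.id ℝ E + t • endAt h z)
  refine ⟨{ inner := B
            symm := fun z v w => ?_
            pos := fun z v hv => ?_
            isVonNBounded := fun z => ?_
            contMDiff := ?_
            hermitian := fun z v w => ?_ }, fun z => rfl⟩
  · have e1 : metricAt g z v w = metricAt g z w v := g.symm z v w
    have e2 : metricAt g z (endAt h z v) w = metricAt g z (endAt h z w) v :=
      (hh.symm z v w).trans (g.symm z _ _)
    exact (happ z v w).trans ((by rw [e1, e2]) : _ = _) |>.trans (happ z w v).symm
  · have h1 : 0 < metricAt g z v v := g.pos z v hv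
    exact (by positivity : (0 : ℝ) < 2⁻¹ * metricAt g z v v).trans_le (hhalf z v)
  · have h1 := (g.isVonNBounded z).image ((2 : ℝ) • ContinuousLinearMap.id ℝ (TangentSpace 𝓘(ℝ, E) z))
    refine h1.subset ?_
    intro v hv
    refine ⟨(2⁻¹ : ℝ) • v, ?_, ?_⟩
    · have h2 : 2⁻¹ * metricAt g z v v < 1 := (hhalf z v).trans_lt hv
      have h3 : g.inner z ((2⁻¹ : ℝ) • v) ((2⁻¹ : ℝ) • v) = 2⁻¹ * (2⁻¹ * metricAt g z v v) := by
        simp only [map_smul, smul_apply, smul_eq_mul]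
        rfl
      simp only [Set.mem_ofPred_eq, h3]
      linarith
    · simp [smul_smul]
  · refine (contMDiff_bilin_iff B).2 fun x => ?_
    refine ContMDiffOn.congr (f := fun z => bilinCoord (metricAt g) x z ∘L
      (ContinuousLinearMap.id ℝ E + t • endCoord (endAt h) x z)) ?_
      fun z hz => bilinCoord_comp_id_add g (endAt h) t hz
    exact (contMDiffOn_bilinCoord g x).clm_comp
      (contMDiffOn_const.add ((contMDiffOn_const :
        ContMDiffOn 𝓘(ℝ, E) 𝓘(ℝ, ℝ) ∞ (fun _ => t) _).smul (contMDiffOn_endCoord h x)))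
  · have e1 : metricAt g z (tangentJ z v) (tangentJ z w) = metricAt g z v w := g.hermitian z v w
    have e2 : metricAt g z (endAt h z (tangentJ z v)) (tangentJ z w) = metricAt g z (endAt h z v) w :=
      (congrArg (fun u => g.inner z u (tangentJ z w)) (hh.comm z v)).trans (g.hermitian z _ _)
    exact (happ z _ _).trans ((by rw [e1, e2]) : _ = _) |>.trans (happ z v w).symm

lemma inChart_deformation {g g' : HermitianMetric E M} {h : SmoothEnd E M} {t : ℝ}
    (hg' : ∀ z, metricAt g' z =
      metricAt g z ∘L (ContinuousLinearMap.id ℝ E + t • endAt h z))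
    (x : M) {y : E} (hy : y ∈ (chartAt E x).target) :
    inChart g' x y = inChart g x y ∘L
      (ContinuousLinearMap.id ℝ E + t • endCoord (endAt h) x ((chartAt E x).symm y)) := by
  rw [inChart_eq g' x hy, inChart_eq g x hy,
    ← bilinCoord_comp_id_add g _ t ((chartAt E x).map_target hy), funext hg']

/-! ### Smoothness and first variation of the Chern-scalar curvature. -/

variable [FiniteDimensional ℂ E]

lemma contMDiffOn_scalCh_deformation {g : HermitianMetric E M} {h : SmoothEnd E M}
    {γ : ℝ → HermitianMetric E M} {I : Set ℝ} (hI : IsOpen I)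
    (hγ : ∀ t ∈ I, ∀ z, metricAt (γ t) z =
      metricAt g z ∘L (ContinuousLinearMap.id ℝ E + t • endAt h z)) :
    ContMDiffOn (𝓘(ℝ, ℝ).prod 𝓘(ℝ, E)) 𝓘(ℝ, ℝ) ∞
      (fun p : ℝ × M => scalCh (γ p.1) p.2) (I ×ˢ Set.univ) := by
  rintro ⟨t, x⟩ ⟨ht, -⟩
  refine ContMDiffAt.contMDiffWithinAt ?_
  set A := fun y => endCoord (endAt h) x ((chartAt E x).symm y) with hAdef
  have hA : ContDiffOn ℝ ∞ A (chartAt E x).target :=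
    contDiffOn_of_contMDiffOn (contMDiffOn_endCoord h x)
  set G : ℝ × E → E →L[ℝ] E →L[ℝ] ℝ := fun p =>
    inChart g x p.2 ∘L (ContinuousLinearMap.id ℝ E + p.1 • A p.2) with hG
  have hO : IsOpen (I ×ˢ (chartAt E x).target) := hI.prod (chartAt E x).open_target
  have hGe : ∀ p ∈ I ×ˢ (chartAt E x).target, inChart (γ p.1) x p.2 = G p := fun p hp =>
    inChart_deformation (hγ p.1 hp.1) x hp.2
  have hGc : ContDiffOn ℝ ∞ G (I ×ˢ (chartAt E x).target) :=
    ((isHermitianOn_inChart g x).contDiffOn.comp contDiffOn_snd fun p hp => hp.2).clm_comp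
      (contDiffOn_const.add (contDiffOn_fst.smul (hA.comp contDiffOn_snd fun p hp => hp.2)))
  have h1 := contDiffOn_chartScal hO hGc fun p hp => by
    rw [← hGe p hp]
    exact (isHermitianOn_inChart (γ p.1) x).isInvertible _ hp.2
  have hxt := mem_chart_target E x
  have h2 : ContMDiffAt 𝓘(ℝ, ℝ × E) 𝓘(ℝ, ℝ) ∞
      (fun p : ℝ × E => chartScal (fun z => G (p.1, z)) p.2) (t, chartAt E x x) :=
    (h1.contDiffAt (hO.mem_nhds ⟨ht, hxt⟩)).contMDiffAt
  have h3 : ContMDiffAt (𝓘(ℝ, ℝ).prod 𝓘(ℝ, E)) 𝓘(ℝ, ℝ × E) ∞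
      (fun p : ℝ × M => (p.1, chartAt E x p.2)) (t, x) := by
    refine contMDiffAt_fst.prodMk_space ?_
    have h4 : ContMDiffAt 𝓘(ℝ, E) 𝓘(ℝ, E) ∞ (chartAt E x) x :=
      (contMDiffOn_chart (I := 𝓘(ℝ, E)) (n := ∞) (x := x)).contMDiffAt
        ((chartAt E x).open_source.mem_nhds (mem_chart_source E x))
    exact h4.comp (t, x) contMDiffAt_snd
  refine (h2.comp (t, x) h3).congr_of_eventuallyEq ?_
  have hO' : IsOpen (I ×ˢ (chartAt E x).source) := hI.prod (chartAt E x).open_source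
  filter_upwards [hO'.mem_nhds ⟨ht, mem_chart_source E x⟩] with p hp
  rw [scalCh_eq _ hp.2]
  refine chartScal_congr (H := fun z => G (p.1, z)) ?_
  filter_upwards [(chartAt E x).open_target.mem_nhds ((chartAt E x).map_source hp.2)] with y hy
  exact hGe (p.1, y) ⟨hp.1, hy⟩

/-- Passing to the chart at x conjugates h by the coordinate change, and traces are conjugation
invariant; the ½ is that of `trC_eq`. -/
lemma trCEnd_eq (h : SmoothEnd E M) {x z : M} (hz : z ∈ (chartAt E x).source) :
    trCEnd h z = 2⁻¹ * traceL E (endCoord (endAt h) x z) := by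
  have h1 : endCoord (endAt h) x z = tangentCoordChange 𝓘(ℝ, E) z x z ∘L
    (endAt h z ∘L tangentCoordChange 𝓘(ℝ, E) x z z) := rfl
  rw [h1, traceL_comp_comm, comp_assoc, tangentCoordChange_comp_self (mem_chart_source E z) hz,
    comp_id]
  exact trC_eq (endAt h z)

lemma diff_trCEnd (h : SmoothEnd E M) (x : M) :
    diff (trCEnd h) x = fderiv ℝ (trCEnd h ∘ (chartAt E x).symm) (chartAt E x x) := by
  have hnx := (chartAt E x).open_source.mem_nhds (mem_chart_source E x)
  have h1 : ContMDiffAt 𝓘(ℝ, E) 𝓘(ℝ, ℝ) ∞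
      (fun z => 2⁻¹ * traceL E (endCoord (endAt h) x z)) x := by
    have h2 := (contMDiffOn_endCoord h x).contMDiffAt hnx
    have h3 : ContDiff ℝ ∞ fun B : E →L[ℝ] E => 2⁻¹ * traceL E B :=
      contDiff_const.mul (traceL E).contDiff
    exact h3.contMDiff.contMDiffAt.comp x h2
  have h2 : MDifferentiableAt 𝓘(ℝ, E) 𝓘(ℝ, ℝ) (trCEnd h) x := by
    refine (h1.congr_of_eventuallyEq ?_).mdifferentiableAt (by simp)
    filter_upwards [hnx] with z hz using trCEnd_eq h hz
  rw [diff, h2.mfderiv]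
  simp [writtenInExtChartAt, fderivWithin_univ]
  rfl

lemma hasDerivAt_scalCh_deformation {g : HermitianMetric E M} {h : SmoothEnd E M}
    (hh : IsSym11 g h) {γ : ℝ → HermitianMetric E M}
    (hγ : ∀ᶠ t in nhds (0 : ℝ), ∀ z, metricAt (γ t) z =
      metricAt g z ∘L (ContinuousLinearMap.id ℝ E + t • endAt h z)) (x : M) :
    HasDerivAt (fun t : ℝ => scalCh (γ t) x)
      (laplacian g (trCEnd h) x + metricCo g x (diff (trCEnd h) x) (leeForm g x) -
        metricEnd g x (h x) (chernRicci g x)) 0 := by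
  have hx := mem_chart_source E x
  have hxt := mem_chart_target E x
  have hG := isHermitianOn_inChart g x
  set y := chartAt E x x with hy
  set A := fun y => endCoord (endAt h) x ((chartAt E x).symm y) with hAdef
  have hA : ContDiffOn ℝ ∞ A (chartAt E x).target :=
    contDiffOn_of_contMDiffOn (contMDiffOn_endCoord h x)
  have hAy : A y = endAt h x := by
    ext v
    have e1 : (chartAt E x).symm y = x := (chartAt E x).left_inv hx
    have e2 : ∀ v, tangentCoordChange 𝓘(ℝ, E) x x x v = v := fun v =>
      tangentCoordChange_self (by simp)
    simp only [hAdef, e1, endCoord, comp_apply, e2]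
  have hGy : inChart g x y = metricAt g x := inChart_self g x
  have h1 := hasDerivAt_chartScal hG hA hxt
  have h2 : (fun t : ℝ => scalCh (γ t) x) =ᶠ[nhds 0] fun t =>
      chartScal (fun z => inChart g x z ∘L (ContinuousLinearMap.id ℝ E + t • A z)) y := by
    filter_upwards [hγ] with t ht
    rw [scalCh_eq (γ t) hx]
    refine chartScal_congr ?_
    filter_upwards [(chartAt E x).open_target.mem_nhds hxt] with z hz
    exact inChart_deformation ht x hz
  refine (h1.congr_of_eventuallyEq h2).congr_deriv ?_
  set u := trCEnd h ∘ (chartAt E x).symm with hu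
  have hue : u =ᶠ[nhds y] fun z => (2⁻¹ : ℝ) * traceL E (A z) := by
    filter_upwards [(chartAt E x).open_target.mem_nhds hxt] with z hz
    exact trCEnd_eq h ((chartAt E x).map_target hz)
  have htr : ContDiffOn ℝ ∞ (fun z => traceL E (A z)) (chartAt E x).target :=
    (traceL E).contDiff.comp_contDiffOn hA
  -- The identity tr^ℂ h = ½ tr A holds on a whole neighbourhood, so it may be differentiated twice.
  have hD2 : fderiv ℝ (fderiv ℝ u) y =
      (2⁻¹ : ℝ) • fderiv ℝ (fderiv ℝ (fun z => traceL E (A z))) y := by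
    have e1 : fderiv ℝ u =ᶠ[nhds y] fun z => (2⁻¹ : ℝ) • fderiv ℝ (fun z => traceL E (A z)) z := by
      filter_upwards [hue.eventuallyEq_nhds, hG.mem_nhds hxt] with z hz hzt
      rw [hz.fderiv_eq]
      exact (((htr.contDiffAt (hG.mem_nhds hzt)).differentiableAt
        (by simp)).hasFDerivAt.const_mul 2⁻¹).fderiv
    rw [e1.fderiv_eq]
    have e2 := (htr.fderiv_of_isOpen (m := ∞) hG.isOpen (by simp)).contDiffAt (hG.mem_nhds hxt)
    exact ((e2.differentiableAt (by simp)).hasFDerivAt.const_smul (2⁻¹ : ℝ)).fderiv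
  have h3 := hG.neg_traceForm_hess_add_coInner hxt u
  have h4 : laplacian g (trCEnd h) x + metricCo g x (diff (trCEnd h) x) (leeForm g x) =
      -traceForm (inChart g x y) (hess (inChart g x) u y) +
        coInner (inChart g x y) (fderiv ℝ u y) (leeFormAux (inChart g x) y) := by
    rw [hGy, laplacian, metricCo, diff_trCEnd]
    rfl
  have hC : ∀ v, A y (cJ E v) = cJ E (A y v) := by
    rw [hAy]
    exact hh.comm x
  have hCs : ∀ v w, inChart g x y (A y v) w = inChart g x y v (A y w) := by
    rw [hAy, hGy]
    exact hh.symm x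
  have h5 := hG.endInner_rhoInv hxt hC hCs
  have h6 : metricEnd g x (h x) (chernRicci g x) =
      endInner (inChart g x y) (A y) (rhoInv (inChart g x y) (chernRicciForm (inChart g x) y)) := by
    rw [hGy, hAy]
    rfl
  rw [h4, h3, h6, h5, hD2, comp_smul, map_smul, smul_eq_mul]
  ring

end Deformation

end ChernScal

end

theorem mainTheorem5 {E : Type*} [NormedAddCommGroup E] [NormedSpace ℂ E]
    [FiniteDimensional ℂ E] {M : Type*} [TopologicalSpace M] [T2Space M] [CompactSpace M]
    [ConnectedSpace M] [ChartedSpace E M] [IsManifold 𝓘(ℂ, E) ω M]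
    (g : ChernScal.HermitianMetric E M) (h : ChernScal.SmoothEnd E M)
    (hh : ChernScal.IsSym11 g h) :
    ∃ ε : ℝ, 0 < ε ∧ ∃ γ : ℝ → ChernScal.HermitianMetric E M,
      (∀ t ∈ Set.Ioo (-ε) ε, ∀ (x : M) (v w : TangentSpace 𝓘(ℝ, E) x),
        (γ t).inner x v w = g.inner x (v + t • h x v) w) ∧
      ContMDiffOn (𝓘(ℝ, ℝ).prod 𝓘(ℝ, E)) 𝓘(ℝ, ℝ) ∞
        (fun p : ℝ × M => ChernScal.scalCh (γ p.1) p.2) (Set.Ioo (-ε) ε ×ˢ Set.univ) ∧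
      ∀ x : M, HasDerivAt (fun t : ℝ => ChernScal.scalCh (γ t) x)
        (ChernScal.laplacian g (ChernScal.trCEnd h) x +
          ChernScal.metricCo g x (ChernScal.diff (ChernScal.trCEnd h) x)
            (ChernScal.leeForm g x) -
          ChernScal.metricEnd g x (h x) (ChernScal.chernRicci g x)) 0 := by
  obtain ⟨C, hC, hb⟩ := ChernScal.exists_global_bound g h
  -- For |t| < 1/(2C) the bound gives |t g(hv, v)| ≤ ½ g(v, v), as `exists_deformation` requires.
  have hε : 0 < (2 * C)⁻¹ := by positivity
  have hex : ∀ t : ℝ, ∃ g' : ChernScal.HermitianMetric E M, t ∈ Set.Ioo (-(2 * C)⁻¹) (2 * C)⁻¹ →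
      ∀ z, ChernScal.metricAt g' z = ChernScal.metricAt g z ∘L
        (ContinuousLinearMap.id ℝ E + t • ChernScal.endAt h z) := by
    intro t
    by_cases ht : t ∈ Set.Ioo (-(2 * C)⁻¹) (2 * C)⁻¹
    · obtain ⟨g', hg'⟩ := ChernScal.exists_deformation g h hh (t := t) fun z v => by
        rw [abs_mul]
        calc |t| * |ChernScal.metricAt g z (ChernScal.endAt h z v) v|
            ≤ (2 * C)⁻¹ * (C * ChernScal.metricAt g z v v) :=
              mul_le_mul (abs_lt.2 ht).le (hb z v) (abs_nonneg _) hε.le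
          _ = _ := by field_simp
      exact ⟨g', fun _ => hg'⟩
    -- Outside the interval the family takes the arbitrary value g; only |t| < ε matters.
    · exact ⟨g, fun h => absurd h ht⟩
  choose γ hγ using hex
  refine ⟨(2 * C)⁻¹, hε, γ, fun t ht x v w => ?_,
    ChernScal.contMDiffOn_scalCh_deformation isOpen_Ioo hγ, fun x =>
      ChernScal.hasDerivAt_scalCh_deformation hh ?_ x⟩
  · exact DFunLike.congr_fun (DFunLike.congr_fun (hγ t ht x) v) w
  · filter_upwards [Ioo_mem_nhds (neg_lt_zero.2 hε) hε] with t ht using hγ t ht
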